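/- **Conventions.** Let $d,s\ge 1$ be integers. $C^s([0,1]^d)$ is the space of functions $f:[0,1]^d\to\mathbb R$ all of whose partial derivatives of order at most $s$ exist (one-sided at the boundary) and are continuous on $[0,1]^d$, with norm $$\|f\|_{C^s([0,1]^d)}=\max\big\{\|\partial^{\alpha}f\|_{L^\infty([0,1]^d)}:\ \alpha\in\mathbb N^d,\ \|\alpha\|_1=\alpha_1+\dots+\alpha_d\le s\big\}.$$ A ReLU feed-forward network with $d$ inputs, one output and $\ell$ hidden layers implements a function $\phi=\mathcal L_{\ell}\circ\sigma\circ\mathcal L_{\ell-1}\circ\cdots\circ\sigma\circ\mathcal L_0:\mathbb R^d\to\mathbb R$, where the $\mathcal L_i$ are affine maps and $\sigma(x)=\max\{0,x\}$ acts coordinatewise. The network is said to have *width $\widetilde N$ and depth $\widetilde L$* if each of its hidden layers has at most $\widetilde N$ nodes and it has at most $\widetilde L$ hidden layers. **Statement.** Let $f\in C^s([0,1]^d)$. For all integers $\widetilde N\ge 17s^{d+1}3^{d+2}d$ and $\widetilde L\ge 108s^2+2d$ there exists a function $\phi:\mathbb R^d\to\mathbb R$ implemented by a ReLU feed-forward network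 with width $\widetilde N$ and depth $\widetilde L$ such that $$\|\phi-f\|_{L^\infty([0,1]^d)}\le \widetilde C_1\,\|f\|_{C^s([0,1]^d)}\Big(\frac{\widetilde N}{\widetilde C_2\log_2(8\widetilde N+8)}\Big)^{-2s/d}\Big(\frac{\widetilde L-2d}{\widetilde C_3\log_2(4\widetilde L+4)}\Big)^{-2s/d},$$ where $\widetilde C_1=85(s+1)^d8^s$, $\widetilde C_2=68s^{d+1}3^dd$ and $\widetilde C_3=72s^2$. -/

import Mathlib

open MeasureTheory
open scoped ENNReal

noncomputable section

/-! ### The space `C^s([0,1]^d)` and its norm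

`f ∈ C^s([0,1]^d)` is Mathlib's `ContDiffOn ℝ s f (unitCube d)`: all partial derivatives of order
at most `s` exist (one-sided at the boundary) and are continuous on the closed cube. -/

/-- The closed unit cube `[0,1]^d`. -/
def unitCube (d : ℕ) : Set (Fin d → ℝ) := Set.Icc 0 1

/-- The `L^∞([0,1]^d)` norm (essential supremum of `|g|` on the cube), with values in `[0,∞]`. -/
def linftyNorm {d : ℕ} (g : (Fin d → ℝ) → ℝ) : ℝ≥0∞ :=
  eLpNorm g ⊤ (volume.restrict (unitCube d))

/-- The partial derivative `∂g/∂x_i` relative to the cube: the derivative of `t ↦ g (x + t e_i)` at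
`t = 0`, where `t` runs through the reals with `x + t e_i ∈ [0,1]^d`. -/
def partialDeriv {d : ℕ} (i : Fin d) (g : (Fin d → ℝ) → ℝ) : (Fin d → ℝ) → ℝ :=
  fun x => lineDerivWithin ℝ g (unitCube d) x (Pi.single i 1)

/-- `∂^α g = ∂_1^{α_1} (∂_2^{α_2} (⋯ (∂_d^{α_d} g)))`. -/
def multiPartialDeriv {d : ℕ} (α : Fin d → ℕ) (g : (Fin d → ℝ) → ℝ) : (Fin d → ℝ) → ℝ :=
  (List.finRange d).foldr (fun i h => (partialDeriv i)^[α i] h) g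

/-- `‖f‖_{C^s([0,1]^d)}`, the maximum of `‖∂^α f‖_{L^∞([0,1]^d)}` over the (finitely many)
multi-indices `α` with `‖α‖₁ ≤ s`. It is finite for every `f ∈ C^s([0,1]^d)`,
see `csNorm_lt_top`. -/
def csNorm {d : ℕ} (s : ℕ) (f : (Fin d → ℝ) → ℝ) : ℝ≥0∞ :=
  ⨆ α ∈ {α : Fin d → ℕ | ∑ i, α i ≤ s}, linftyNorm (multiPartialDeriv α f)

/-- On the cube the partial derivatives of a continuously differentiable function are values of its
Fréchet derivative. -/
theorem partialDeriv_eq {d : ℕ} {g : (Fin d → ℝ) → ℝ} (hg : DifferentiableOn ℝ g (unitCube d))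
    (i : Fin d) {x : Fin d → ℝ} (hx : x ∈ unitCube d) :
    partialDeriv i g x = fderivWithin ℝ g (unitCube d) x (Pi.single i 1) := by
  have h := (hg x hx).hasFDerivWithinAt.hasLineDerivWithinAt (Pi.single i (1 : ℝ))
  refine HasDerivWithinAt.derivWithin h ?_
  have hset : (fun t : ℝ => x + t • (Pi.single i 1 : Fin d → ℝ)) ⁻¹' (unitCube d)
      = Set.Icc (-x i) (1 - x i) := by
    obtain ⟨h0, h1⟩ := hx
    ext t
    simp only [unitCube, Set.mem_preimage, Set.mem_Icc, Pi.le_def]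
    constructor
    · rintro ⟨ha, hb⟩
      have ha := ha i
      have hb := hb i
      simp at ha hb
      constructor <;> linarith
    · rintro ⟨ha, hb⟩
      constructor <;> intro j <;> have h0 := h0 j <;> have h1 := h1 j <;>
        by_cases hj : j = i
      · subst hj; simp; linarith
      · simpa [hj] using h0
      · subst hj; simp; linarith
      · simpa [hj] using h1
  rw [hset]
  have h0 := hx.1 i
  have h1 := hx.2 i
  simp at h0 h1
  exact uniqueDiffOn_Icc (by linarith) 0 ⟨by linarith, by linarith⟩

theorem uniqueDiffOn_unitCube (d : ℕ) : UniqueDiffOn ℝ (unitCube d) := by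
  have : unitCube d = Set.univ.pi fun _ : Fin d => Set.Icc (0 : ℝ) 1 :=
    (Set.pi_univ_Icc (0 : Fin d → ℝ) 1).symm
  rw [this]
  exact UniqueDiffOn.univ_pi fun _ => uniqueDiffOn_Icc one_pos

theorem contDiffOn_partialDeriv {d n : ℕ} {g : (Fin d → ℝ) → ℝ}
    (hg : ContDiffOn ℝ (n + 1 : ℕ) g (unitCube d)) (i : Fin d) :
    ContDiffOn ℝ n (partialDeriv i g) (unitCube d) := by
  have h1 : ContDiffOn ℝ n (fun x => fderivWithin ℝ g (unitCube d) x (Pi.single i 1))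
      (unitCube d) :=
    (hg.fderivWithin (uniqueDiffOn_unitCube d) (by norm_cast)).clm_apply contDiffOn_const
  exact h1.congr fun x hx => partialDeriv_eq (hg.differentiableOn (by norm_cast)) i hx

theorem contDiffOn_multiPartialDeriv {d s : ℕ} {f : (Fin d → ℝ) → ℝ}
    (hf : ContDiffOn ℝ s f (unitCube d)) {α : Fin d → ℕ} (hα : ∑ i, α i ≤ s) :
    ContDiffOn ℝ (s - ∑ i, α i : ℕ) (multiPartialDeriv α f) (unitCube d) := by
  have iter : ∀ (i : Fin d) (k n : ℕ) (g : (Fin d → ℝ) → ℝ),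
      ContDiffOn ℝ (n + k : ℕ) g (unitCube d) →
        ContDiffOn ℝ n ((partialDeriv i)^[k] g) (unitCube d) := by
    intro i k
    induction k with
    | zero => intro n g hg; simpa using hg
    | succ k ih =>
      intro n g hg
      rw [Function.iterate_succ_apply]
      exact ih n _ (contDiffOn_partialDeriv (n := n + k) hg i)
  have key : ∀ (l : List (Fin d)) (n : ℕ), ContDiffOn ℝ (n + (l.map α).sum : ℕ) f (unitCube d) →
      ContDiffOn ℝ n (l.foldr (fun i h => (partialDeriv i)^[α i] h) f) (unitCube d) := by
    intro l
    induction l with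
    | nil => intro n h; simpa using h
    | cons i l ih =>
      intro n h
      refine iter i (α i) n _ (ih (n + α i) ?_)
      simpa [add_assoc] using h
  refine key (List.finRange d) _ ?_
  rw [← List.ofFn_eq_map, List.sum_ofFn, Nat.sub_add_cancel hα]
  exact hf

theorem csNorm_lt_top {d s : ℕ} {f : (Fin d → ℝ) → ℝ} (hf : ContDiffOn ℝ s f (unitCube d)) :
    csNorm s f < ⊤ := by
  have hfin : {α : Fin d → ℕ | ∑ i, α i ≤ s}.Finite :=
    (Set.finite_Iic (fun _ : Fin d => s)).subset fun α hα i =>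
      (Finset.single_le_sum (fun j _ => Nat.zero_le (α j)) (Finset.mem_univ i)).trans hα
  have hsup : csNorm s f = hfin.toFinset.sup fun α => linftyNorm (multiPartialDeriv α f) := by
    simp [csNorm, Finset.sup_eq_iSup]
  rw [hsup, Finset.sup_lt_iff (by simp)]
  intro α hα
  rw [Set.Finite.mem_toFinset] at hα
  have hK : IsCompact (unitCube d) := isCompact_Icc
  obtain ⟨C, hC⟩ := hK.exists_bound_of_continuousOn
    (contDiffOn_multiPartialDeriv hf hα).continuousOn
  refine lt_of_le_of_lt ?_ (ENNReal.ofReal_lt_top (r := C))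
  rw [linftyNorm, eLpNorm_exponent_top]
  exact eLpNormEssSup_le_of_ae_bound
    ((ae_restrict_iff' hK.measurableSet).2 (Filter.Eventually.of_forall hC))

/-! ### ReLU feed-forward networks -/

/-- A ReLU feed-forward network with `n` inputs and `m` outputs: an affine output map, preceded by
any number of hidden layers, each with its weight matrix, bias vector and number of nodes `k`. -/
inductive ReLUNet : ℕ → ℕ → Type
  | output {n m : ℕ} (W : Matrix (Fin m) (Fin n) ℝ) (b : Fin m → ℝ) : ReLUNet n m
  | hidden {n k m : ℕ} (W : Matrix (Fin k) (Fin n) ℝ) (b : Fin k → ℝ) (rest : ReLUNet k m) :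
      ReLUNet n m

/-- The function implemented by a network, `𝓛_L ∘ σ ∘ 𝓛_{L-1} ∘ ⋯ ∘ σ ∘ 𝓛_0`, with
`σ x = max 0 x` applied to each coordinate. -/
def ReLUNet.eval {n m : ℕ} : ReLUNet n m → (Fin n → ℝ) → (Fin m → ℝ)
  | .output W b, x => fun j => W.mulVec x j + b j
  | .hidden W b rest, x => rest.eval fun j => max 0 (W.mulVec x j + b j)

/-- The number of hidden layers. -/
def ReLUNet.depth {n m : ℕ} : ReLUNet n m → ℕ
  | .output _ _ => 0
  | .hidden _ _ rest => rest.depth + 1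

/-- The maximum number of nodes in a hidden layer. -/
def ReLUNet.width {n m : ℕ} : ReLUNet n m → ℕ
  | .output _ _ => 0
  | .hidden (k := k) _ _ rest => max k rest.width

/-- `φ : ℝ^d → ℝ` is implemented by a ReLU network of width `N` and depth `L`: all hidden layers
have at most `N` nodes, and there are at most `L` hidden layers. -/
def ImplementedByReLUNet {d : ℕ} (N L : ℕ) (φ : (Fin d → ℝ) → ℝ) : Prop :=
  ∃ net : ReLUNet d 1, net.width ≤ N ∧ net.depth ≤ L ∧ ∀ x, φ x = net.eval x 0

end

/-! The cube is cut into `K ^ d` cells with `K = (K₁ K₂)²`, where `K₁`, `K₂` are the integer parts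
of the `d`-th roots of `n`, `ℓ`. There are thus about `n² ℓ²` cells, of side about `(n ℓ) ^ (-2 /
d)`. Replacing `f` on each cell by its Taylor polynomial of degree `< s` at the centre
(`exists_taylor_along`) costs an error of the desired order `K ^ (-s)`. The task is to evaluate this
piecewise polynomial with width about `n log n` and depth about `ℓ log ℓ`.

Each coordinate is scaled by `Q = P K` and truncated to an integer `k`. Steep ramps extract the
digits of `k` (`Reach.digits`): `k / P` names the cell and `k % P` the position inside it. After
this truncation the arithmetic is exact except that coefficients have finitely many bits. No
approximate multiplication is needed, because every product has a digit or a bit as one factor, and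
for `|v| ≤ 1` the product of `v` with a 0/1 number is one ReLU up to an affine correction
(`relu_mul_indicator`).

The rate comes from bit storage (`Reach.signed_bits`). A cell is coded by `a, b < n` and `c, e < ℓ`.
One-hot encodings of `a`, `b` select among `n²` weights in a layer, the layers run through the `ℓ`
values of `c`, and each weight is an integer holding `g` bits for every `e < ℓ`. Thus `g` bits for
each of `n² ℓ²` cells are read with width `O(n)` and depth `O(ℓ g)`. With `m = log₂ (4 n)` and `g =
log₂ (4 ℓ)`, rounded down, `s m` parallel blocks of `g` signed bits give a coefficient to precision
`(n ℓ) ^ (-2 s)`; these are the logarithms in the rate.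

The ramps fail where the fractional part of the scaled coordinate exceeds `2/3`. Among a coordinate
and its shifts by `± 1 / (3 Q)` at most one is bad, so medians of shifted copies, one coordinate
after another, repair the network (`Reach.exists_uniform`) at the cost of a factor `3 ^ d` in width
and `2 d` layers. Finally `exists_parameter` chooses `n`, `ℓ` for the given size. -/

/-! ### Layers of ReLU features -/

/-- The affine combinations of a set of real functions. -/
def affineHull {X : Type*} (S : Set (X → ℝ)) : Submodule ℝ (X → ℝ) :=
  Submodule.span ℝ (insert 1 S)

/-- The rectifier applied to the values of a function. -/
def relu {X : Type*} (g : X → ℝ) : X → ℝ := fun x => max 0 (g x)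

/-- Every function in `S'` is an affine combination of at most `W` rectified affine combinations
of functions in `S`. -/
def LayerReach {X : Type*} (W : ℕ) (S S' : Set (X → ℝ)) : Prop :=
  ∃ G : Finset (X → ℝ), G.card ≤ W ∧ (∀ g ∈ G, g ∈ affineHull S) ∧
    S' ⊆ affineHull (relu '' (G : Set (X → ℝ)))

/-- Every function in `S'` is computed from functions in `S` by `t` hidden layers of at most
`W` nodes. -/
def Reach {X : Type*} (W : ℕ) : ℕ → Set (X → ℝ) → Set (X → ℝ) → Prop
  | 0, S, S' => S' ⊆ affineHull S
  | t + 1, S, S' => ∃ S₁, LayerReach W S S₁ ∧ Reach W t S₁ S'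

section AffineHull

variable {X : Type*} {S S' : Set (X → ℝ)} {f g : X → ℝ}

theorem subset_affineHull : S ⊆ affineHull S :=
  (Set.subset_insert _ _).trans Submodule.subset_span

theorem affineHull_const (c : ℝ) : (fun _ => c) ∈ affineHull S := by
  have h : (1 : X → ℝ) ∈ affineHull S := Submodule.subset_span (Set.mem_insert _ _)
  have := (affineHull S).smul_mem c h
  convert this using 1
  funext x
  simp

theorem affineHull_congr (hf : f ∈ affineHull S) (h : ∀ x, g x = f x) : g ∈ affineHull S := by
  rwa [funext h]

theorem affineHull_add (hf : f ∈ affineHull S) (hg : g ∈ affineHull S) :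
    (fun x => f x + g x) ∈ affineHull S :=
  (affineHull S).add_mem hf hg

theorem affineHull_sub (hf : f ∈ affineHull S) (hg : g ∈ affineHull S) :
    (fun x => f x - g x) ∈ affineHull S :=
  (affineHull S).sub_mem hf hg

theorem affineHull_mul (c : ℝ) (hf : f ∈ affineHull S) : (fun x => c * f x) ∈ affineHull S :=
  (affineHull S).smul_mem c hf

theorem affineHull_sum {ι : Type*} {I : Finset ι} {F : ι → X → ℝ}
    (hF : ∀ i ∈ I, F i ∈ affineHull S) : (fun x => ∑ i ∈ I, F i x) ∈ affineHull S := by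
  have := (affineHull S).sum_mem hF
  convert this using 1
  funext x
  simp

theorem affineHull_le (h : S ⊆ affineHull S') : affineHull S ≤ affineHull S' := by
  refine Submodule.span_le.2 (Set.insert_subset ?_ h)
  exact Submodule.subset_span (Set.mem_insert _ _)

theorem affineHull_mono (h : S ⊆ S') : affineHull S ≤ affineHull S' :=
  affineHull_le (h.trans subset_affineHull)

end AffineHull

/-! ### Composition, parallel union and carrying of features. -/

section Reach

variable {X : Type*} {S S₁ S₂ S' : Set (X → ℝ)} {f g : X → ℝ} {W W' t t' : ℕ}

theorem LayerReach.mono_left (h : LayerReach W S₁ S') (hS : S₁ ⊆ affineHull S) :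
    LayerReach W S S' := by
  obtain ⟨G, h1, h2, h3⟩ := h
  exact ⟨G, h1, fun g hg => affineHull_le hS (h2 g hg), h3⟩

theorem Reach.mono_left (h : Reach W t S₁ S') (hS : S₁ ⊆ affineHull S) : Reach W t S S' := by
  cases t with
  | zero => exact h.trans (affineHull_le hS)
  | succ t =>
    obtain ⟨S₂, h1, h2⟩ := h
    exact ⟨S₂, h1.mono_left hS, h2⟩

theorem Reach.mono_right (h : Reach W t S S₁) (hS : S' ⊆ affineHull S₁) : Reach W t S S' := by
  induction t generalizing S with
  | zero => exact hS.trans (affineHull_le h)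
  | succ t ih =>
    obtain ⟨S₂, h1, h2⟩ := h
    exact ⟨S₂, h1, ih h2⟩

theorem Reach.mono_width (h : Reach W t S S') (hW : W ≤ W') : Reach W' t S S' := by
  induction t generalizing S with
  | zero => exact h
  | succ t ih =>
    obtain ⟨S₂, ⟨G, h1, h2, h3⟩, h4⟩ := h
    exact ⟨S₂, ⟨G, h1.trans hW, h2, h3⟩, ih h4⟩

theorem Reach.trans (h : Reach W t S S₁) (h' : Reach W t' S₁ S') : Reach W (t + t') S S' := by
  induction t generalizing S with
  | zero => rw [zero_add]; exact h'.mono_left h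
  | succ t ih =>
    obtain ⟨S₂, h1, h2⟩ := h
    rw [add_right_comm]
    exact ⟨S₂, h1, ih h2⟩

theorem Reach.union (h₁ : Reach W t S S₁) (h₂ : Reach W' t S S₂) :
    Reach (W + W') t S (S₁ ∪ S₂) := by
  classical
  induction t generalizing S with
  | zero => exact Set.union_subset h₁ h₂
  | succ t ih =>
    obtain ⟨T₁, ⟨G₁, a1, b1, c1⟩, d1⟩ := h₁
    obtain ⟨T₂, ⟨G₂, a2, b2, c2⟩, d2⟩ := h₂
    refine ⟨T₁ ∪ T₂, ⟨G₁ ∪ G₂, (Finset.card_union_le _ _).trans (add_le_add a1 a2), ?_, ?_⟩,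
      ih (d1.mono_left ?_) (d2.mono_left ?_)⟩
    · intro g hg
      rcases Finset.mem_union.1 hg with hg | hg
      exacts [b1 g hg, b2 g hg]
    · refine Set.union_subset (c1.trans (affineHull_mono ?_)) (c2.trans (affineHull_mono ?_)) <;>
        apply Set.image_mono <;> simp
    · exact Set.subset_union_left.trans subset_affineHull
    · exact Set.subset_union_right.trans subset_affineHull

theorem Reach.biUnion {ι : Type*} (I : Finset ι) {F : ι → Set (X → ℝ)}
    (h : ∀ i ∈ I, Reach W t S (F i)) : Reach (I.card * W) t S (⋃ i ∈ I, F i) := by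
  classical
  induction I using Finset.induction_on with
  | empty =>
    have : ∀ t (S : Set (X → ℝ)), Reach 0 t S (∅ : Set (X → ℝ)) := by
      intro t
      induction t with
      | zero => intro S; exact Set.empty_subset _
      | succ t ih => intro S; exact ⟨∅, ⟨∅, by simp, by simp, by simp⟩, ih _⟩
    simpa using this t S
  | insert i I hi ih =>
    rw [Finset.card_insert_of_notMem hi, Finset.set_biUnion_insert]
    refine ((h i (by simp)).union (ih fun j hj => h j (by simp [hj]))).mono_width ?_
    rw [add_mul, one_mul, add_comm]

theorem Reach.iUnion {ι : Type*} [Fintype ι] {F : ι → Set (X → ℝ)}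
    (h : ∀ i, Reach W t S (F i)) : Reach (Fintype.card ι * W) t S (⋃ i, F i) := by
  simpa using Reach.biUnion Finset.univ fun i _ => h i

theorem Reach.single (hg : g ∈ affineHull S) : Reach 1 1 S {relu g} :=
  ⟨{relu g}, ⟨{g}, by simp, by simpa, by simpa using subset_affineHull (S := {relu g}) rfl⟩,
    subset_affineHull⟩

/-- A function that is bounded below passes through any number of layers, using one node each. -/
theorem Reach.carry {c : ℝ} (hc : ∀ x, c ≤ g x) (hg : g ∈ affineHull S) : Reach 1 t S {g} := by
  induction t generalizing S with
  | zero => simpa [Reach] using hg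
  | succ t ih =>
    rw [add_comm]
    refine Reach.trans (S₁ := {g}) ?_ (ih (subset_affineHull rfl))
    -- `g - c` is nonnegative, so the ReLU leaves it unchanged, and the next affine map adds `c`
    -- back.
    refine (Reach.single (affineHull_sub hg (affineHull_const c))).mono_right ?_
    rw [Set.singleton_subset_iff]
    exact affineHull_congr (affineHull_add (subset_affineHull rfl) (affineHull_const c))
      fun x => by simp [relu, hc x]

/-- Any function passes through any number of layers, using two nodes each. -/
theorem Reach.carry_two (hg : g ∈ affineHull S) : Reach 2 t S {g} := by
  induction t generalizing S with
  | zero => simpa [Reach] using hg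
  | succ t ih =>
    rw [add_comm]
    refine Reach.trans (S₁ := {g}) ?_ (ih (subset_affineHull rfl))
    refine ((Reach.single hg).union (Reach.single (affineHull_mul (-1) hg))).mono_right ?_
    rw [Set.singleton_subset_iff]
    refine affineHull_congr
      (affineHull_sub (subset_affineHull (Or.inl rfl)) (subset_affineHull (Or.inr rfl)))
      fun x => ?_
    rcases le_total 0 (g x) with h | h <;> simp [relu, h]

/-- A function that is computed in fewer layers is also computed in `t'` layers. -/
theorem Reach.pad (h : Reach W t S {g}) (hW : 2 ≤ W) (ht : t ≤ t') : Reach W t' S {g} := by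
  obtain ⟨k, rfl⟩ := Nat.exists_eq_add_of_le ht
  exact h.trans ((Reach.carry_two (S := {g}) (subset_affineHull rfl)).mono_width hW)

end Reach

/-! ### From layers of features to networks and back -/

theorem mem_affineHull_range {X : Type*} {n : ℕ} {u : Fin n → X → ℝ} {φ : X → ℝ}
    (h : φ ∈ affineHull (Set.range u)) :
    ∃ (w : Fin n → ℝ) (b : ℝ), ∀ x, φ x = ∑ i, w i * u i x + b := by
  obtain ⟨b, z, hz, rfl⟩ := Submodule.mem_span_insert.1 h
  obtain ⟨w, rfl⟩ := (Submodule.mem_span_range_iff_exists_fun ℝ).1 hz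
  exact ⟨w, b, fun x => by simp [add_comm]⟩

/-- Together with `ReLUNet.reach` this changes the domain: a construction that is valid only for
functions on a subset of `ℝ^d` yields concrete weights, and these define a function on all of `ℝ^d`.
-/
theorem Reach.exists_net {X : Type*} {n W t : ℕ} {u : Fin n → X → ℝ} {S' : Set (X → ℝ)}
    {φ : X → ℝ} (h : Reach W t (Set.range u) S') (hφ : φ ∈ affineHull S') :
    ∃ net : ReLUNet n 1, net.width ≤ W ∧ net.depth = t ∧
      ∀ x, net.eval (fun i => u i x) 0 = φ x := by
  induction t generalizing n with
  | zero =>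
    obtain ⟨w, b, hwb⟩ := mem_affineHull_range (affineHull_le h hφ)
    refine ⟨.output (fun _ i => w i) fun _ => b, by simp [ReLUNet.width], rfl, fun x => ?_⟩
    simp [ReLUNet.eval, hwb, Matrix.mulVec, dotProduct]
  | succ t ih =>
    obtain ⟨S₁, ⟨G, h1, h2, h3⟩, h4⟩ := h
    have hG : ∀ j : Fin G.card, ∃ (w : Fin n → ℝ) (b : ℝ),
        ∀ x, (G.equivFin.symm j : X → ℝ) x = ∑ i, w i * u i x + b := fun j =>
      mem_affineHull_range (h2 _ (G.equivFin.symm j).2)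
    choose w b hwb using hG
    have h5 : Reach W t (Set.range fun j => relu (G.equivFin.symm j : X → ℝ)) S' := by
      refine h4.mono_left (h3.trans (affineHull_mono ?_))
      rintro _ ⟨g, hg, rfl⟩
      exact ⟨G.equivFin ⟨g, hg⟩, by simp⟩
    obtain ⟨net, n1, n2, n3⟩ := ih h5
    refine ⟨.hidden (fun j i => w j i) b net, max_le h1 n1, by simp [ReLUNet.depth, n2],
      fun x => ?_⟩
    rw [← n3 x]
    simp [ReLUNet.eval, relu, hwb, Matrix.mulVec, dotProduct]

theorem ReLUNet.reach {X : Type*} {n m : ℕ} (net : ReLUNet n m) {u : Fin n → X → ℝ}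
    {S : Set (X → ℝ)} (hu : ∀ i, u i ∈ affineHull S) :
    Reach net.width net.depth S (Set.range fun j x => net.eval (fun i => u i x) j) := by
  have lin : ∀ {n m : ℕ} {S : Set (X → ℝ)} {u : Fin n → X → ℝ} (_ : ∀ i, u i ∈ affineHull S)
      (W : Matrix (Fin m) (Fin n) ℝ) (b : Fin m → ℝ) (j : Fin m),
      (fun x => W.mulVec (fun i => u i x) j + b j) ∈ affineHull S := fun hu W b j =>
    affineHull_add (f := fun x => ∑ i, W j i * _) (affineHull_sum fun i _ =>
      affineHull_mul _ (hu i)) (affineHull_const _)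
  induction net generalizing S with
  | output W b =>
    rintro _ ⟨j, rfl⟩
    exact lin hu W b j
  | @hidden n k m W b rest ih =>
    classical
    have h := ih (u := fun j => relu fun x => W.mulVec (fun i => u i x) j + b j)
      (S := Set.range fun j => relu fun x => W.mulVec (fun i => u i x) j + b j)
      fun j => subset_affineHull ⟨j, rfl⟩
    refine ⟨_, ⟨Finset.univ.image fun j x => W.mulVec (fun i => u i x) j + b j, ?_, ?_, ?_⟩,
      h.mono_width (le_max_right _ _)⟩
    · exact (Finset.card_image_le.trans (by simp)).trans (le_max_left k rest.width)
    · intro g hg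
      obtain ⟨j, -, rfl⟩ := Finset.mem_image.1 hg
      exact lin hu W b j
    · refine Set.Subset.trans ?_ subset_affineHull
      rintro _ ⟨j, rfl⟩
      exact ⟨_, by simp, rfl⟩

/-! ### Digits and thresholds -/

/-- `z` exceeds the natural number `k` by at most `2/3`. -/
def NearFloor {X : Type*} (z : X → ℝ) (k : X → ℕ) : Prop :=
  ∀ x, (k x : ℝ) ≤ z x ∧ z x ≤ k x + 2 / 3

/-- The indicator function of `τ ≤ k`. -/
def indGE {X : Type*} (τ : ℕ) (k : X → ℕ) : X → ℝ := fun x => if τ ≤ k x then 1 else 0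

/-- The indicator function of `k = τ`. -/
def indEq {X : Type*} (τ : ℕ) (k : X → ℕ) : X → ℝ := fun x => if k x = τ then 1 else 0

section Digits

variable {X : Type*} {S : Set (X → ℝ)} {z : X → ℝ} {k : X → ℕ}

theorem nearFloor_natCast (k : X → ℕ) : NearFloor (fun x => (k x : ℝ)) k :=
  fun x => ⟨le_rfl, by norm_num⟩

theorem NearFloor.nonneg (h : NearFloor z k) (x : X) : 0 ≤ z x :=
  (Nat.cast_nonneg _).trans (h x).1

/-- The excess over the integer is unchanged when a multiple of `q` is removed, so the remainder can
be fed to the next digit extraction. -/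
theorem NearFloor.sub_digit (h : NearFloor z k) (q : ℕ) :
    NearFloor (fun x => z x - q * (k x / q : ℕ)) (fun x => k x % q) := by
  intro x
  have h1 : ((k x % q : ℕ) : ℝ) = k x - q * (k x / q : ℕ) := by
    rw [eq_sub_iff_add_eq]
    exact_mod_cast Nat.mod_add_div (k x) q
  have := h x
  constructor <;> simp only [h1] <;> linarith

theorem indGE_nonneg (τ : ℕ) (k : X → ℕ) (x : X) : 0 ≤ indGE τ k x := by
  unfold indGE; split_ifs <;> norm_num

theorem indEq_nonneg (τ : ℕ) (k : X → ℕ) (x : X) : 0 ≤ indEq τ k x := by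
  unfold indEq; split_ifs <;> norm_num

/-- A ramp of slope 3 rises from 0 to 1 on `[τ - 1/3, τ]`. A value that exceeds its integer part by
at most `2/3` is never strictly inside this interval, so the ramp is an exact indicator. -/
theorem Reach.threshold (h : NearFloor z k) (hz : z ∈ affineHull S) (τ : ℕ) :
    Reach 2 1 S {indGE τ k} := by
  have h1 := Reach.single (S := S) (affineHull_sub hz (affineHull_const ((τ : ℝ) - 1 / 3)))
  have h2 := Reach.single (S := S) (affineHull_sub hz (affineHull_const (τ : ℝ)))
  refine (h1.union h2).mono_right (Set.singleton_subset_iff.2 ?_)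
  refine affineHull_congr (affineHull_sub (affineHull_mul 3 (subset_affineHull (Or.inl rfl)))
    (affineHull_mul 3 (subset_affineHull (Or.inr rfl)))) fun x => ?_
  obtain ⟨h3, h4⟩ := h x
  simp only [relu, indGE]
  split_ifs with hx
  · have : (τ : ℝ) ≤ k x := by exact_mod_cast hx
    rw [max_eq_right (by linarith), max_eq_right (by linarith)]
    ring
  · have : (k x : ℝ) + 1 ≤ τ := by exact_mod_cast not_le.1 hx
    rw [max_eq_left (by linarith), max_eq_left (by linarith)]
    ring

theorem Reach.threshold_eq (h : NearFloor z k) (hz : z ∈ affineHull S) (τ : ℕ) :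
    Reach 4 1 S {indEq τ k} := by
  refine ((Reach.threshold h hz τ).union (Reach.threshold h hz (τ + 1))).mono_right
    (Set.singleton_subset_iff.2 ?_)
  refine affineHull_congr (affineHull_sub (subset_affineHull (Or.inl rfl))
    (subset_affineHull (Or.inr rfl))) fun x => ?_
  simp only [indGE, indEq]
  split_ifs <;> first | omega | norm_num

theorem sum_indGE {q R : ℕ} (hq : 0 < q) {x : X} (hk : k x < q * R) :
    ∑ u ∈ Finset.range R, indGE ((u + 1) * q) k x = (k x / q : ℕ) := by
  have h1 : k x / q < R := Nat.div_lt_of_lt_mul hk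
  simp only [indGE, ← Nat.le_div_iff_mul_le hq]
  rw [Finset.sum_boole]
  have h2 : {u ∈ Finset.range R | u + 1 ≤ k x / q} = Finset.range (k x / q) := by
    ext u
    simp only [Finset.mem_filter, Finset.mem_range]
    omega
  rw [h2, Finset.card_range]

/-- The quotient counts the positive multiples of `q` up to `k`; here all `R` thresholds are tested
side by side. `Reach.digit_deep` tests them one after the other, trading width for depth. -/
theorem Reach.digit_wide (h : NearFloor z k) (hz : z ∈ affineHull S) {q R : ℕ} (hq : 0 < q)
    (hk : ∀ x, k x < q * R) :
    Reach (2 * R + 1) 1 S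
      {fun x => ((k x / q : ℕ) : ℝ), fun x => z x - q * (k x / q : ℕ)} := by
  have h1 := Reach.biUnion (Finset.range R) fun u _ => Reach.threshold h hz ((u + 1) * q)
  have h2 : Reach 1 1 S {z} := Reach.carry h.nonneg hz
  refine ((h1.union h2).mono_right ?_).mono_width (by simp [mul_comm])
  set S₁ := (⋃ u ∈ Finset.range R, {indGE ((u + 1) * q) k}) ∪ {z}
  have h3 : (fun x => ((k x / q : ℕ) : ℝ)) ∈ affineHull S₁ := by
    refine affineHull_congr (affineHull_sum (I := Finset.range R)
      fun u hu => subset_affineHull (Or.inl ?_)) fun x => (sum_indGE hq (hk x)).symm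
    exact Set.mem_biUnion hu rfl
  refine Set.insert_subset h3 (Set.singleton_subset_iff.2 ?_)
  exact affineHull_sub (subset_affineHull (Or.inr rfl)) (affineHull_mul _ h3)

theorem Reach.digit_deep (h : NearFloor z k) (hz : z ∈ affineHull S) {q R : ℕ} (hq : 0 < q)
    (hk : ∀ x, k x < q * R) :
    Reach 4 R S {fun x => ((k x / q : ℕ) : ℝ), fun x => z x - q * (k x / q : ℕ)} := by
  have key : ∀ t, Reach 4 t S
      ({z} ∪ {fun x => ∑ u ∈ Finset.range t, indGE ((u + 1) * q) k x}) := by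
    intro t
    induction t with
    | zero =>
      refine Set.union_subset (by simpa) (Set.singleton_subset_iff.2 ?_)
      simpa using affineHull_const (S := S) 0
    | succ t ih =>
      refine ih.trans ?_
      set S₁ := ({z} : Set (X → ℝ)) ∪
        {fun x => ∑ u ∈ Finset.range t, indGE ((u + 1) * q) k x}
      have hz' : z ∈ affineHull S₁ := subset_affineHull (Or.inl rfl)
      have a1 : Reach 1 1 S₁ {z} := Reach.carry h.nonneg hz'
      have a2 : Reach 1 1 S₁
          {fun x => ∑ u ∈ Finset.range t, indGE ((u + 1) * q) k x} :=
        Reach.carry (c := 0) (fun x => Finset.sum_nonneg fun u _ => indGE_nonneg _ _ _)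
          (subset_affineHull (Or.inr rfl))
      refine ((a1.union a2).union (Reach.threshold h hz' ((t + 1) * q))).mono_right ?_
      refine Set.union_subset (Set.singleton_subset_iff.2 (subset_affineHull ?_))
        (Set.singleton_subset_iff.2 ?_)
      · exact Or.inl (Or.inl rfl)
      · refine affineHull_congr (affineHull_add (subset_affineHull (Or.inl (Or.inr rfl)))
          (subset_affineHull (Or.inr rfl))) fun x => ?_
        rw [Finset.sum_range_succ]
  refine (key R).mono_right ?_
  have h3 : (fun x => ((k x / q : ℕ) : ℝ)) ∈ affineHull (({z} : Set (X → ℝ)) ∪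
      {fun x => ∑ u ∈ Finset.range R, indGE ((u + 1) * q) k x}) :=
    affineHull_congr (subset_affineHull (Or.inr rfl)) fun x => (sum_indGE hq (hk x)).symm
  refine Set.insert_subset h3 (Set.singleton_subset_iff.2 ?_)
  exact affineHull_sub (subset_affineHull (Or.inl rfl)) (affineHull_mul _ h3)

theorem Reach.carry_natCast {m : X → ℕ} {t : ℕ} (hm : (fun x => (m x : ℝ)) ∈ affineHull S) :
    Reach 1 t S {fun x => (m x : ℝ)} :=
  Reach.carry (fun x => Nat.cast_nonneg (m x)) hm

/-- The digits of `k` in the mixed radix `K₁, K₁, K₂, K₂, P`. -/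
theorem Reach.digits (h : NearFloor z k) (hz : z ∈ affineHull S) {K₁ K₂ P : ℕ} (h₁ : 0 < K₁)
    (h₂ : 0 < K₂) (hP : 0 < P) (hk : ∀ x, k x < P * K₂ * K₂ * K₁ * K₁) :
    ∃ r : X → ℝ, NearFloor r (fun x => k x % P) ∧ Reach (2 * K₁ + 7) (2 + 2 * K₂) S
      {fun x => ((k x / (P * K₂ * K₂ * K₁) : ℕ) : ℝ),
        fun x => ((k x % (P * K₂ * K₂ * K₁) / (P * K₂ * K₂) : ℕ) : ℝ),
        fun x => ((k x % (P * K₂ * K₂) / (P * K₂) : ℕ) : ℝ),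
        fun x => ((k x % (P * K₂) / P : ℕ) : ℝ), r} := by
  have m₁ : ∀ x, k x % (P * K₂ * K₂ * K₁) % (P * K₂ * K₂) = k x % (P * K₂ * K₂) := fun x =>
    Nat.mod_mod_of_dvd _ (Dvd.intro _ rfl)
  have m₂ : ∀ x, k x % (P * K₂ * K₂) % (P * K₂) = k x % (P * K₂) := fun x =>
    Nat.mod_mod_of_dvd _ (Dvd.intro _ rfl)
  have m₃ : ∀ x, k x % (P * K₂) % P = k x % P := fun x => Nat.mod_mod_of_dvd _ (Dvd.intro _ rfl)
  have g₁ := h.sub_digit (P * K₂ * K₂ * K₁)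
  have g₂ := g₁.sub_digit (P * K₂ * K₂)
  have g₃ := g₂.sub_digit (P * K₂)
  have g₄ := g₃.sub_digit P
  simp only [m₁, m₂, m₃] at g₂ g₃ g₄
  set a : X → ℝ := fun x => ((k x / (P * K₂ * K₂ * K₁) : ℕ) : ℝ)
  set b : X → ℝ := fun x => ((k x % (P * K₂ * K₂ * K₁) / (P * K₂ * K₂) : ℕ) : ℝ)
  set c : X → ℝ := fun x => ((k x % (P * K₂ * K₂) / (P * K₂) : ℕ) : ℝ)
  set e : X → ℝ := fun x => ((k x % (P * K₂) / P : ℕ) : ℝ)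
  refine ⟨_, g₄, ?_⟩
  have e₁ := Reach.digit_wide h hz (by positivity) hk
  have e₂ := (Reach.digit_wide (S := {a, _}) g₁ (subset_affineHull (Or.inr rfl))
    (q := P * K₂ * K₂) (R := K₁) (by positivity) fun x => Nat.mod_lt _ (by positivity)).union
    (Reach.carry_natCast (subset_affineHull (Or.inl rfl)))
  have e₃ := ((Reach.digit_deep (S := {b, _} ∪ {a}) g₂ (subset_affineHull (Or.inl (Or.inr rfl)))
    (q := P * K₂) (R := K₂) (by positivity) fun x => Nat.mod_lt _ (by positivity)).union
    (Reach.carry_natCast (subset_affineHull (Or.inr rfl)))).union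
    (Reach.carry_natCast (subset_affineHull (Or.inl (Or.inl rfl))))
  have e₄ := (((Reach.digit_deep (S := {c, _} ∪ {a} ∪ {b}) g₃
    (subset_affineHull (Or.inl (Or.inl (Or.inr rfl))))
    (q := P) (R := K₂) (by positivity) fun x => Nat.mod_lt _ (by positivity)).union
    (Reach.carry_natCast (subset_affineHull (Or.inl (Or.inr rfl))))).union
    (Reach.carry_natCast (subset_affineHull (Or.inr rfl)))).union
    (Reach.carry_natCast (subset_affineHull (Or.inl (Or.inl (Or.inl rfl)))))
  have e := (((e₁.mono_width (W' := 2 * K₁ + 7) (by omega)).trans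
    (e₂.mono_width (by omega))).trans (e₃.mono_width (by omega))).trans
    (e₄.mono_width (by omega))
  rw [show 2 + 2 * K₂ = 1 + 1 + K₂ + K₂ by ring]
  refine e.mono_right (Set.Subset.trans ?_ subset_affineHull)
  rintro f (rfl | rfl | rfl | rfl | rfl)
  exacts [Or.inl (Or.inl (Or.inr rfl)), Or.inl (Or.inr rfl), Or.inr rfl,
    Or.inl (Or.inl (Or.inl (Or.inl rfl))), Or.inl (Or.inl (Or.inl (Or.inr rfl)))]

end Digits

/-! ### Products with digits, table lookup, bit extraction -/

section Arithmetic

variable {X : Type*} {S : Set (X → ℝ)}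

theorem relu_mul_indicator {v θ : ℝ} (hv : |v| ≤ 1) (hθ : θ = 0 ∨ θ = 1) :
    max 0 (v - 1 + 2 * θ) = v * θ + θ := by
  obtain ⟨h1, h2⟩ := abs_le.1 hv
  rcases hθ with rfl | rfl
  · rw [max_eq_left (by linarith)]; ring
  · rw [max_eq_right (by linarith)]; ring

theorem indGE_eq_zero_or_one (τ : ℕ) (k : X → ℕ) (x : X) : indGE τ k x = 0 ∨ indGE τ k x = 1 := by
  unfold indGE; split_ifs <;> simp

theorem indEq_eq_zero_or_one (τ : ℕ) (k : X → ℕ) (x : X) : indEq τ k x = 0 ∨ indEq τ k x = 1 := by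
  unfold indEq; split_ifs <;> simp

/-- Multiplication of `v` by the integer part of `r`, one base-`B` digit at a time. -/
theorem Reach.mul_digits {B : ℕ} (hB : 0 < B) {v : X → ℝ} (hv : ∀ x, |v x| ≤ 1) (T : ℕ) :
    ∀ {S : Set (X → ℝ)} {acc r : X → ℝ} {k : X → ℕ} {C : ℝ}, (∀ x, C ≤ acc x) →
      NearFloor r k → (∀ x, k x < B ^ T) → acc ∈ affineHull S → r ∈ affineHull S →
      v ∈ affineHull S → Reach (2 * B + 3) (2 * T) S {fun x => acc x + v x * k x, v} := by
  induction T with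
  | zero =>
    intro S acc r k C _ _ hk hacc _ hvS
    refine Set.insert_subset (affineHull_congr hacc fun x => ?_) (Set.singleton_subset_iff.2 hvS)
    have : k x = 0 := by simpa using hk x
    simp [this]
  | succ T ih =>
    intro S acc r k C hC hr hk hacc hrS hvS
    have hq : 0 < B ^ T := by positivity
    have hk' : ∀ x, k x < B ^ T * B := fun x => by simpa [pow_succ] using hk x
    set θ : ℕ → X → ℝ := fun u => indGE ((u + 1) * B ^ T) k with hθ
    have hsum : ∀ x, ((k x / B ^ T : ℕ) : ℝ) = ∑ u ∈ Finset.range B, θ u x := fun x =>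
      (sum_indGE hq (hk' x)).symm
    set S₁ := ({acc} : Set (X → ℝ)) ∪ {v} ∪ {r} ∪ ⋃ u ∈ Finset.range B, {θ u} with hS₁
    have l₁ : Reach (2 * B + 3) 1 S S₁ := by
      refine ((((Reach.carry hC hacc).union (Reach.carry (c := -1)
        (fun x => (abs_le.1 (hv x)).1) hvS)).union (Reach.carry hr.nonneg hrS)).union
        (Reach.biUnion (Finset.range B) fun u _ =>
          Reach.threshold hr hrS ((u + 1) * B ^ T))).mono_width ?_
      rw [Finset.card_range]; omega
    have acc₁ : acc ∈ affineHull S₁ := subset_affineHull (by simp [hS₁])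
    have v₁ : v ∈ affineHull S₁ := subset_affineHull (by simp [hS₁])
    have r₁ : r ∈ affineHull S₁ := subset_affineHull (by simp [hS₁])
    have θ₁ : ∀ u ∈ Finset.range B, θ u ∈ affineHull S₁ := fun u hu =>
      subset_affineHull (Or.inr (Set.mem_biUnion hu rfl))
    have D₁ : (fun x => ((k x / B ^ T : ℕ) : ℝ)) ∈ affineHull S₁ :=
      affineHull_congr (affineHull_sum θ₁) hsum
    -- The ReLUs of the next layer sum to `v D + D`, where `D` is the current digit. The surplus,
    -- scaled by `B ^ T`, is subtracted now, while the indicators that express `D` are still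
    -- available.
    set acc' : X → ℝ := fun x => acc x - (B ^ T : ℕ) * (k x / B ^ T : ℕ) with hacc'
    set r' : X → ℝ := fun x => r x - (B ^ T : ℕ) * (k x / B ^ T : ℕ) with hr'
    have hr'' := hr.sub_digit (B ^ T)
    have hD : ∀ x, ((k x / B ^ T : ℕ) : ℝ) ≤ B := fun x => by
      exact_mod_cast (Nat.div_lt_of_lt_mul (hk' x)).le
    set P : ℕ → X → ℝ := fun u => relu fun x => v x - 1 + 2 * θ u x with hP
    set S₂ := ({acc'} : Set (X → ℝ)) ∪ {v} ∪ {r'} ∪ ⋃ u ∈ Finset.range B, {P u} with hS₂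
    have l₂ : Reach (2 * B + 3) 1 S₁ S₂ := by
      refine ((((Reach.carry (c := C - (B ^ T : ℕ) * B) (fun x => ?_)
        (affineHull_sub acc₁ (affineHull_mul _ D₁))).union (Reach.carry (c := -1)
        (fun x => (abs_le.1 (hv x)).1) v₁)).union (Reach.carry hr''.nonneg
        (affineHull_sub r₁ (affineHull_mul _ D₁)))).union
        (Reach.biUnion (Finset.range B) fun u hu =>
          Reach.single (affineHull_add (affineHull_sub v₁ (affineHull_const 1))
            (affineHull_mul 2 (θ₁ u hu))))).mono_width ?_
      · gcongr
        exacts [hC x, by exact_mod_cast hD x]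
      · rw [Finset.card_range]; omega
    have acc₂ : acc' ∈ affineHull S₂ := subset_affineHull (by simp [hS₂])
    have v₂ : v ∈ affineHull S₂ := subset_affineHull (by simp [hS₂])
    have r₂ : r' ∈ affineHull S₂ := subset_affineHull (by simp [hS₂])
    have P₂ : ∀ u ∈ Finset.range B, P u ∈ affineHull S₂ := fun u hu =>
      subset_affineHull (Or.inr (Set.mem_biUnion hu rfl))
    have hPsum : ∀ x, ∑ u ∈ Finset.range B, P u x = v x * (k x / B ^ T : ℕ) + (k x / B ^ T : ℕ) := by
      intro x
      rw [hsum, Finset.mul_sum, ← Finset.sum_add_distrib]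
      exact Finset.sum_congr rfl fun u _ => relu_mul_indicator (hv x) (indGE_eq_zero_or_one _ _ _)
    have new : (fun x => acc x + (B ^ T : ℕ) * (v x * (k x / B ^ T : ℕ))) ∈ affineHull S₂ := by
      refine affineHull_congr (affineHull_add acc₂ (affineHull_mul (B ^ T : ℕ)
        (affineHull_sum P₂))) fun x => ?_
      rw [hPsum, hacc']
      ring
    have l₃ := ih (C := C - (B ^ T : ℕ) * B) (fun x => ?_) hr''
      (fun x => Nat.mod_lt _ hq) new r₂ v₂
    · have := (l₁.trans l₂).trans l₃
      rw [show 2 * (T + 1) = 1 + 1 + 2 * T by ring]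
      refine this.mono_right ?_
      refine Set.insert_subset (affineHull_congr (subset_affineHull (Or.inl rfl)) fun x => ?_)
        (Set.singleton_subset_iff.2 (subset_affineHull (Or.inr rfl)))
      have : (k x : ℝ) = (k x % B ^ T : ℕ) + (B ^ T : ℕ) * (k x / B ^ T : ℕ) := by
        exact_mod_cast (Nat.mod_add_div _ _).symm
      rw [this]
      ring
    · have h1 : -(B : ℝ) ≤ v x * (k x / B ^ T : ℕ) := by
        have h2 : |v x * (k x / B ^ T : ℕ)| ≤ 1 * B := by
          rw [abs_mul, Nat.abs_cast]
          exact mul_le_mul (hv x) (hD x) (Nat.cast_nonneg _) zero_le_one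
        linarith [(abs_le.1 h2).1]
      have h2 := mul_le_mul_of_nonneg_left h1 (Nat.cast_nonneg (α := ℝ) (B ^ T))
      linarith [hC x]

/-- The coordinate in `[-1, 1]` that corresponds to `k ∈ {0, …, P}`. -/
noncomputable def signedFraction (P : ℕ) (k : ℕ) : ℝ := 2 * k / P - 1

theorem abs_signedFraction_le {P k : ℕ} (hk : k < P) : |signedFraction P k| ≤ 1 := by
  have hP : (0 : ℝ) < P := by exact_mod_cast (Nat.zero_le k).trans_lt hk
  have h1 : (k : ℝ) ≤ P := by exact_mod_cast hk.le
  rw [signedFraction, abs_le]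
  constructor
  · have : 0 ≤ 2 * (k : ℝ) / P := by positivity
    linarith
  · have : 2 * (k : ℝ) / P ≤ 2 := by rw [div_le_iff₀ hP]; linarith
    linarith

theorem abs_prod_signedFraction_le {ι : Type*} {P : ℕ} {k : ι → ℕ} (hk : ∀ i, k i < P)
    (l : List ι) : |(l.map fun i => signedFraction P (k i)).prod| ≤ 1 := by
  induction l with
  | nil => simp
  | cons i l ih =>
    rw [List.map_cons, List.prod_cons, abs_mul]
    exact mul_le_one₀ (abs_signedFraction_le (hk i)) (abs_nonneg _) ih

/-- A factor `2 k / P - 1` sends `v` to `(2 / P) (v k) - v`, so each factor needs only one product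
with an integer, and the partial products stay in `[-1, 1]` as `Reach.mul_digits` requires. The
`Fintype.card ι` extra nodes carry the positions to the later factors. -/
theorem Reach.monomial {ι : Type*} [Fintype ι] {B T : ℕ} (hB : 0 < B) {r : ι → X → ℝ}
    {k : ι → X → ℕ} (hr : ∀ i, NearFloor (r i) (k i)) (hk : ∀ i x, k i x < B ^ T) (l : List ι) :
    ∀ {S : Set (X → ℝ)}, (∀ i, r i ∈ affineHull S) →
      Reach (2 * B + 3 + Fintype.card ι) (2 * T * l.length) S
        {fun x => (l.map fun i => signedFraction (B ^ T) (k i x)).prod} := by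
  suffices h : ∀ {S : Set (X → ℝ)}, (∀ i, r i ∈ affineHull S) →
      Reach (2 * B + 3 + Fintype.card ι) (2 * T * l.length) S
        ({fun x => (l.map fun i => signedFraction (B ^ T) (k i x)).prod} ∪ ⋃ i, {r i}) from
    fun {S} hS => (h hS).mono_right (Set.subset_union_left.trans subset_affineHull)
  intro S hS
  induction l with
  | nil =>
    refine Set.union_subset ?_ (Set.iUnion_subset fun i => Set.singleton_subset_iff.2 (hS i))
    simpa using affineHull_const (S := S) 1
  | cons i l ih =>
    set v : X → ℝ := fun x => (l.map fun i => signedFraction (B ^ T) (k i x)).prod with hv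
    set S₁ := ({v} : Set (X → ℝ)) ∪ ⋃ i, {r i}
    have r₁ : ∀ i, r i ∈ affineHull S₁ := fun i =>
      subset_affineHull (Or.inr (Set.mem_iUnion.2 ⟨i, rfl⟩))
    have h1 := Reach.mul_digits hB (v := v) (acc := fun _ => 0) (C := 0)
      (fun x => abs_prod_signedFraction_le (hk · x) l) T (fun _ => le_rfl) (hr i) (hk i)
      (affineHull_const 0) (r₁ i) (subset_affineHull (Or.inl rfl))
    have h2 := Reach.iUnion fun j => Reach.carry (t := 2 * T) (hr j).nonneg (r₁ j)
    have h3 := ih.trans ((h1.union h2).mono_width (by simp))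
    rw [List.length_cons, mul_add, mul_one]
    refine h3.mono_right (Set.union_subset (Set.singleton_subset_iff.2 ?_)
      (Set.subset_union_right.trans subset_affineHull))
    refine affineHull_congr (affineHull_sub (affineHull_mul (2 / (B ^ T : ℕ) : ℝ)
      (subset_affineHull (Or.inl (Or.inl rfl)))) (subset_affineHull (Or.inl (Or.inr rfl))))
      fun x => ?_
    rw [List.map_cons, List.prod_cons, signedFraction, hv]
    ring

/-- Selection of the entry `Y (c x) (a x) (b x)` of a table from the one-hot encodings of `a` and
`b`. -/
theorem Reach.table {n : ℕ} {a b c : X → ℕ} (ha : ∀ x, a x < n) (hb : ∀ x, b x < n)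
    {Y : ℕ → ℕ → ℕ → ℕ} {M : ℕ} (hY : ∀ c a b, Y c a b ≤ M)
    (haS : ∀ u ∈ Finset.range n, indEq u a ∈ affineHull S)
    (hbS : ∀ u ∈ Finset.range n, indEq u b ∈ affineHull S)
    (hcS : (fun x => (c x : ℝ)) ∈ affineHull S) {ℓ : ℕ} (hc : ∀ x, c x < ℓ) :
    Reach (3 * n + 6) (2 * ℓ) S {fun x => (Y (c x) (a x) (b x) : ℝ)} := by
  set E : Set (X → ℝ) := (⋃ u ∈ Finset.range n, {indEq u a}) ∪
    (⋃ u ∈ Finset.range n, {indEq u b}) ∪ {fun x => (c x : ℝ)} with hE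
  have carryE : ∀ {S' : Set (X → ℝ)}, E ⊆ affineHull S' → Reach (n + n + 1) 1 S' E := by
    intro S' hS'
    have h := ((Reach.biUnion (t := 1) (Finset.range n) fun u hu => Reach.carry (indEq_nonneg u a)
      (hS' (Or.inl (Or.inl (Set.mem_biUnion hu rfl))))).union
      (Reach.biUnion (Finset.range n) fun u hu => Reach.carry (indEq_nonneg u b)
        (hS' (Or.inl (Or.inr (Set.mem_biUnion hu rfl)))))).union
      (Reach.carry_natCast (hS' (Or.inr rfl)))
    rw [Finset.card_range, mul_one] at h
    exact h
  -- The entry is picked up at stage `t = c x`; before that the accumulator is `0`, and afterwards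
  -- it is only carried.
  set m : ℕ → X → ℕ := fun t x => if c x < t then Y (c x) (a x) (b x) else 0 with hm
  set A : ℕ → X → ℝ := fun t x => (m t x : ℝ) with hA
  suffices key : ∀ t, Reach (3 * n + 6) (2 * t) S (E ∪ {A t}) by
    refine (key ℓ).mono_right (Set.singleton_subset_iff.2
      (affineHull_congr (subset_affineHull (Or.inr rfl)) fun x => ?_))
    simp [hA, hm, hc x]
  intro t
  induction t with
  | zero =>
    refine Set.union_subset (Set.union_subset (Set.union_subset ?_ ?_) ?_) ?_
    · exact Set.iUnion₂_subset fun u hu => Set.singleton_subset_iff.2 (haS u hu)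
    · exact Set.iUnion₂_subset fun u hu => Set.singleton_subset_iff.2 (hbS u hu)
    · exact Set.singleton_subset_iff.2 hcS
    · exact Set.singleton_subset_iff.2 (affineHull_congr (affineHull_const 0) fun x => by simp [hA, hm])
  | succ t ih =>
    have A₀ : A t ∈ affineHull (E ∪ {A t}) := subset_affineHull (Or.inr rfl)
    have c₀ : (fun x => (c x : ℝ)) ∈ affineHull (E ∪ {A t}) :=
      subset_affineHull (Or.inl (Or.inr rfl))
    have l₁ : Reach (3 * n + 6) 1 (E ∪ {A t}) (E ∪ {A t} ∪ {indEq t c}) :=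
      (((carryE (Set.subset_union_left.trans subset_affineHull)).union
        (Reach.carry_natCast A₀)).union
        (Reach.threshold_eq (nearFloor_natCast c) c₀ t)).mono_width
        (by omega)
    set S₁ := E ∪ {A t} ∪ {indEq t c}
    have a₁ : ∀ u ∈ Finset.range n, indEq u a ∈ affineHull S₁ := fun u hu =>
      subset_affineHull (Or.inl (Or.inl (Or.inl (Or.inl (Set.mem_biUnion hu rfl)))))
    have b₁ : ∀ u ∈ Finset.range n, indEq u b ∈ affineHull S₁ := fun u hu =>
      subset_affineHull (Or.inl (Or.inl (Or.inl (Or.inr (Set.mem_biUnion hu rfl)))))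
    have A₁ : A t ∈ affineHull S₁ := subset_affineHull (Or.inl (Or.inr rfl))
    -- The inner sum reads the entry for the actual `a`. The penalty `M`, a bound for all entries,
    -- silences the node unless both `b = u` and `c = t`.
    set G : ℕ → X → ℝ := fun u => relu fun x =>
      ∑ w ∈ Finset.range n, (Y t w u : ℝ) * indEq w a x +
        M * (indEq u b x + indEq t c x - 2) with hG
    have l₂ : Reach (3 * n + 6) 1 S₁ (E ∪ {A t} ∪ ⋃ u ∈ Finset.range n, {G u}) := by
      refine (((carryE (Set.subset_union_left.trans (Set.subset_union_left.trans
        subset_affineHull))).union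
        (Reach.carry_natCast A₁)).union
        (Reach.biUnion (Finset.range n) fun u hu => Reach.single ?_)).mono_width
        (by rw [Finset.card_range]; omega)
      exact affineHull_add (affineHull_sum fun w hw => affineHull_mul _ (a₁ w hw))
        (affineHull_mul _ (affineHull_sub (affineHull_add (b₁ u hu)
          (subset_affineHull (Or.inr rfl))) (affineHull_const 2)))
    rw [show 2 * (t + 1) = 2 * t + 1 + 1 by ring]
    refine ((ih.trans l₁).trans l₂).mono_right (Set.union_subset
      (Set.subset_union_left.trans (Set.subset_union_left.trans subset_affineHull))
      (Set.singleton_subset_iff.2 ?_))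
    refine affineHull_congr (affineHull_add (subset_affineHull (Or.inl (Or.inr rfl)))
      (affineHull_sum (I := Finset.range n) (F := G) fun u hu =>
        subset_affineHull (Or.inr (Set.mem_biUnion hu rfl)))) fun x => ?_
    have hGx : ∀ u, G u x = if b x = u then (if c x = t then (Y t (a x) u : ℝ) else 0) else 0 := by
      intro u
      have h1 : ∑ w ∈ Finset.range n, (Y t w u : ℝ) * indEq w a x = Y t (a x) u := by
        simp [indEq, ha x]
      have h2 : (Y t (a x) u : ℝ) ≤ M := by exact_mod_cast hY _ _ _
      have h3 : (0 : ℝ) ≤ Y t (a x) u := Nat.cast_nonneg _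
      simp only [hG, relu, h1]
      simp only [indEq]
      split_ifs
      · rw [max_eq_right (by linarith)]; ring
      · rw [max_eq_left (by linarith)]
      · rw [max_eq_left (by linarith)]
      · rw [max_eq_left (by linarith)]
    simp only [hGx, hA, hm]
    rw [Finset.sum_ite_eq, if_pos (Finset.mem_range.2 (hb x))]
    split_ifs <;> first | omega | simp_all

/-- Extraction of the bits `θ` of a natural number, accumulating `ω t * v` for the bits that are set
at positions `t` with `κ t = e`. -/
theorem Reach.bits {v : X → ℝ} (hv : ∀ x, |v x| ≤ 1) {e : X → ℕ} (Λ : ℕ) :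
    ∀ {S : Set (X → ℝ)} {acc : X → ℝ} {C : ℝ} {θ : ℕ → X → ℕ} {ω : ℕ → ℝ} {κ : ℕ → ℕ},
      (∀ t x, θ t x ≤ 1) → (∀ x, C ≤ acc x) → acc ∈ affineHull S → v ∈ affineHull S →
      (fun x => (e x : ℝ)) ∈ affineHull S →
      (fun x => ((∑ t ∈ Finset.range Λ, θ t x * 2 ^ (Λ - 1 - t) : ℕ) : ℝ)) ∈ affineHull S →
      Reach 10 (2 * Λ) S
        {fun x => acc x + ∑ t ∈ Finset.range Λ, ω t * (v x * (θ t x * indEq (κ t) e x)), v} := by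
  induction Λ with
  | zero =>
    intro S acc C θ ω κ hθ hC hacc hvS heS hy
    refine Set.insert_subset (affineHull_congr hacc fun x => by simp)
      (Set.singleton_subset_iff.2 hvS)
  | succ Λ ih =>
    intro S acc C θ ω κ hθ hC hacc hvS heS hy
    set y : X → ℕ := fun x => ∑ t ∈ Finset.range (Λ + 1), θ t x * 2 ^ (Λ + 1 - 1 - t) with hy_def
    set y' : X → ℕ := fun x => ∑ t ∈ Finset.range Λ, θ (t + 1) x * 2 ^ (Λ - 1 - t) with hy'_def
    have hyy' : ∀ x, y x = y' x + θ 0 x * 2 ^ Λ := by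
      intro x
      simp only [hy_def, hy'_def]
      rw [Finset.sum_range_succ']
      simp only [Nat.add_sub_cancel, Nat.sub_zero]
      congr 1
      refine Finset.sum_congr rfl fun t _ => ?_
      rw [show Λ - (t + 1) = Λ - 1 - t by omega]
    have hy'lt : ∀ x, y' x < 2 ^ Λ := by
      intro x
      have h1 : y' x ≤ ∑ t ∈ Finset.range Λ, 2 ^ (Λ - 1 - t) :=
        Finset.sum_le_sum fun t _ => by
          simpa using Nat.mul_le_mul_right (2 ^ (Λ - 1 - t)) (hθ (t + 1) x)
      rw [Finset.sum_range_reflect (fun t => 2 ^ t) Λ] at h1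
      exact h1.trans_lt (Nat.geomSum_lt le_rfl fun t ht => Finset.mem_range.1 ht)
    -- Bits are stored most significant first, and the remaining ones sum to less than `2 ^ Λ`, so
    -- one threshold reads the leading bit.
    have hbit : ∀ x, indGE (2 ^ Λ) y x = θ 0 x := by
      intro x
      have h1 := hyy' x
      have h2 := hy'lt x
      unfold indGE
      rcases Nat.le_one_iff_eq_zero_or_eq_one.1 (hθ 0 x) with h | h <;> rw [h] at h1 ⊢
      · rw [if_neg (by omega)]; simp
      · rw [if_pos (by omega)]; simp
    set S₁ := ({acc} : Set (X → ℝ)) ∪ {v} ∪ {fun x => (e x : ℝ)} ∪ {fun x => (y x : ℝ)} ∪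
      {indGE (2 ^ Λ) y} ∪ {indEq (κ 0) e} with hS₁
    have l₁ : Reach 10 1 S S₁ :=
      (((((Reach.carry hC hacc).union (Reach.carry (c := -1)
        (fun x => (abs_le.1 (hv x)).1) hvS)).union (Reach.carry_natCast heS)).union
        (Reach.carry_natCast hy)).union (Reach.threshold (nearFloor_natCast y) hy _)).union
        (Reach.threshold_eq (nearFloor_natCast e) heS _)
    have acc₁ : acc ∈ affineHull S₁ := subset_affineHull (by simp [hS₁])
    have v₁ : v ∈ affineHull S₁ := subset_affineHull (by simp [hS₁])
    have e₁ : (fun x => (e x : ℝ)) ∈ affineHull S₁ := subset_affineHull (by simp [hS₁])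
    have y₁ : (fun x => (y x : ℝ)) ∈ affineHull S₁ := subset_affineHull (by simp [hS₁])
    have θ₁ : (fun x => (θ 0 x : ℝ)) ∈ affineHull S₁ :=
      affineHull_congr (f := indGE (2 ^ Λ) y) (subset_affineHull (by simp [hS₁]))
        fun x => (hbit x).symm
    have δ₁ : indEq (κ 0) e ∈ affineHull S₁ := subset_affineHull (by simp [hS₁])
    have y'₁ : (fun x => (y' x : ℝ)) ∈ affineHull S₁ :=
      affineHull_congr (affineHull_sub y₁ (affineHull_mul (2 ^ Λ) θ₁)) fun x => by
        rw [hyy']; push_cast; ring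
    -- When both indicators are 1, `p = v + 1` and `q = 1`; otherwise both vanish. Hence `p - q` is
    -- the gated value of `v`.
    set p : X → ℝ := relu fun x => v x + 2 * θ 0 x + 2 * indEq (κ 0) e x - 3 with hp
    set q : X → ℝ := relu fun x => θ 0 x + indEq (κ 0) e x - 1 with hq
    set S₂ := ({acc} : Set (X → ℝ)) ∪ {v} ∪ {fun x => (e x : ℝ)} ∪ {fun x => (y' x : ℝ)} ∪
      {p} ∪ {q} with hS₂
    have l₂ : Reach 10 1 S₁ S₂ :=
      ((((((Reach.carry hC acc₁).union (Reach.carry (c := -1)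
        (fun x => (abs_le.1 (hv x)).1) v₁)).union (Reach.carry_natCast e₁)).union
        (Reach.carry_natCast y'₁)).union (Reach.single (affineHull_sub (affineHull_add
          (affineHull_add v₁ (affineHull_mul 2 θ₁)) (affineHull_mul 2 δ₁))
          (affineHull_const 3)))).union (Reach.single (affineHull_sub (affineHull_add θ₁ δ₁)
          (affineHull_const 1)))).mono_width (by norm_num)
    have hpq : ∀ x, p x - q x = v x * (θ 0 x * indEq (κ 0) e x) := by
      intro x
      obtain ⟨h1, h2⟩ := abs_le.1 (hv x)
      simp only [hp, hq, relu]
      rcases Nat.le_one_iff_eq_zero_or_eq_one.1 (hθ 0 x) with h | h <;>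
        rcases indEq_eq_zero_or_one (κ 0) e x with h' | h' <;> rw [h, h'] <;> push_cast
      · rw [max_eq_left (by linarith), max_eq_left (by linarith)]; ring
      · rw [max_eq_left (by linarith), max_eq_left (by linarith)]; ring
      · rw [max_eq_left (by linarith), max_eq_left (by linarith)]; ring
      · rw [max_eq_right (by linarith), max_eq_right (by linarith)]; ring
    have new : (fun x => acc x + ω 0 * (v x * (θ 0 x * indEq (κ 0) e x))) ∈
        affineHull S₂ := by
      refine affineHull_congr (affineHull_add (f := acc) (subset_affineHull (by simp [hS₂]))
        (affineHull_mul (ω 0) (affineHull_sub (f := p) (g := q) (subset_affineHull (by simp [hS₂]))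
          (subset_affineHull (by simp [hS₂]))))) fun x => ?_
      rw [hpq]
    have l₃ := ih (S := S₂) (C := C - |ω 0|) (θ := fun t => θ (t + 1)) (ω := fun t => ω (t + 1))
      (κ := fun t => κ (t + 1)) (fun t => hθ (t + 1)) (fun x => ?_) new
      (subset_affineHull (by simp [hS₂])) (subset_affineHull (by simp [hS₂]))
      (subset_affineHull (Or.inl (Or.inl (Or.inr rfl))))
    · rw [show 2 * (Λ + 1) = 1 + 1 + 2 * Λ by ring]
      refine ((l₁.trans l₂).trans l₃).mono_right ?_
      refine Set.insert_subset (affineHull_congr (subset_affineHull (Or.inl rfl)) fun x => ?_)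
        (Set.singleton_subset_iff.2 (subset_affineHull (Or.inr rfl)))
      rw [Finset.sum_range_succ']
      ring
    · have h1 : |ω 0 * (v x * (θ 0 x * indEq (κ 0) e x))| ≤ |ω 0| := by
        rw [abs_mul]
        refine mul_le_of_le_one_right (abs_nonneg _) ?_
        rw [abs_mul]
        refine mul_le_one₀ (hv x) (abs_nonneg _) ?_
        have h2 : (θ 0 x : ℝ) ≤ 1 := by exact_mod_cast hθ 0 x
        rcases indEq_eq_zero_or_one (κ 0) e x with h' | h' <;> rw [h'] <;> simp [h2]
      linarith [hC x, (abs_le.1 h1).1]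

end Arithmetic

/-! ### A network for one monomial with digits of its coefficient looked up in a table -/

/-- The number with base-`K` digits `f`. -/
def radixCode {d : ℕ} (K : ℕ) (f : Fin d → ℕ) : ℕ := ∑ i, f i * K ^ (i : ℕ)

theorem radixCode_eq {d K : ℕ} {f : Fin d → ℕ} (hf : ∀ i, f i < K) :
    radixCode K f = (finFunctionFinEquiv fun i => (⟨f i, hf i⟩ : Fin K) : Fin (K ^ d)) := by
  rw [finFunctionFinEquiv_apply]
  rfl

theorem radixCode_lt {d K : ℕ} {f : Fin d → ℕ} (hf : ∀ i, f i < K) : radixCode K f < K ^ d := by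
  rw [radixCode_eq hf]
  exact Fin.is_lt _

theorem radixCode_inj {d K : ℕ} {f g : Fin d → ℕ} (hf : ∀ i, f i < K) (hg : ∀ i, g i < K)
    (h : radixCode K f = radixCode K g) : f = g := by
  rw [radixCode_eq hf, radixCode_eq hg] at h
  have := finFunctionFinEquiv.injective (Fin.ext h)
  funext i
  simpa using congrFun this i

/-- Used to pack blocks of bits into one string and to split a string into blocks. -/
theorem sum_range_mul_div_mod {M : Type*} [AddCommMonoid M] (m n : ℕ) (F : ℕ → ℕ → M) :
    ∑ t ∈ Finset.range (m * n), F (t / n) (t % n) =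
      ∑ i ∈ Finset.range m, ∑ j ∈ Finset.range n, F i j := by
  induction m with
  | zero => simp
  | succ m ih =>
    rw [add_mul, one_mul, Finset.sum_range_add, ih, Finset.sum_range_succ]
    congr 1
    refine Finset.sum_congr rfl fun j hj => ?_
    have hj := Finset.mem_range.1 hj
    have h1 : (m * n + j) / n = m := by
      rw [mul_comm, Nat.mul_add_div (by omega), Nat.div_eq_of_lt hj, add_zero]
    have h2 : (m * n + j) % n = j := by
      rw [mul_comm, Nat.mul_add_mod, Nat.mod_eq_of_lt hj]
    rw [h1, h2]

section Monomial

variable {X : Type*} {S : Set (X → ℝ)}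

/-- Given natural numbers `a, b < n` and `c, e < ℓ`, a number `v ∈ [-1, 1]` and `ℓ n² ℓ g` bits
`θ`, the network computes `v` times the number with the signed bits `2 θ j - 1`. -/
theorem Reach.signed_bits {n ℓ g : ℕ} {a b c e : X → ℕ} (ha : ∀ x, a x < n) (hb : ∀ x, b x < n)
    (hc : ∀ x, c x < ℓ) (he : ∀ x, e x < ℓ) {v : X → ℝ} (hv : ∀ x, |v x| ≤ 1)
    {θ : ℕ → ℕ × ℕ × ℕ × ℕ → ℕ} (hθ : ∀ j p, θ j p ≤ 1)
    (haS : (fun x => (a x : ℝ)) ∈ affineHull S) (hbS : (fun x => (b x : ℝ)) ∈ affineHull S)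
    (hcS : (fun x => (c x : ℝ)) ∈ affineHull S) (heS : (fun x => (e x : ℝ)) ∈ affineHull S)
    (hvS : v ∈ affineHull S) :
    Reach (8 * n + 10) (1 + 2 * ℓ + 2 * (ℓ * g)) S
      {fun x => ∑ j ∈ Finset.range g,
        (1 / 2) ^ (j + 1) * (2 * (θ j (a x, b x, c x, e x) : ℝ) - 1) * v x} := by
  have hv' : ∀ x, -1 ≤ v x := fun x => (abs_le.1 (hv x)).1
  have l₁ := ((((Reach.biUnion (Finset.range n) fun u _ =>
    Reach.threshold_eq (nearFloor_natCast a) haS u).union (Reach.biUnion (Finset.range n) fun u _ =>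
    Reach.threshold_eq (nearFloor_natCast b) hbS u)).union (Reach.carry_natCast hcS)).union
    (Reach.carry_natCast heS)).union (Reach.carry hv' hvS)
  set S₁ := (⋃ u ∈ Finset.range n, {indEq u a}) ∪ (⋃ u ∈ Finset.range n, {indEq u b}) ∪
    {fun x => (c x : ℝ)} ∪ {fun x => (e x : ℝ)} ∪ {v}
  set θ' : ℕ → X → ℕ := fun t x => θ (t % g) (a x, b x, c x, t / g) with hθ'
  -- One table entry holds the bits for all `e < ℓ`: position `t` belongs to `e = t / g` and to bit
  -- number `t % g`. The gate in `Reach.bits` keeps only the block of the actual `e`.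
  set Y : ℕ → ℕ → ℕ → ℕ := fun c a b =>
    ∑ t ∈ Finset.range (ℓ * g), θ (t % g) (a, b, c, t / g) * 2 ^ (ℓ * g - 1 - t)
  have hY : ∀ c a b, Y c a b ≤ ∑ t ∈ Finset.range (ℓ * g), 1 * 2 ^ (ℓ * g - 1 - t) := fun c a b =>
    Finset.sum_le_sum fun t _ => Nat.mul_le_mul_right _ (hθ _ _)
  have l₂ := ((Reach.table (S := S₁) ha hb hY
    (fun u hu => subset_affineHull (Or.inl (Or.inl (Or.inl (Or.inl (Set.mem_biUnion hu rfl))))))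
    (fun u hu => subset_affineHull (Or.inl (Or.inl (Or.inl (Or.inr (Set.mem_biUnion hu rfl))))))
    (subset_affineHull (Or.inl (Or.inl (Or.inr rfl)))) hc).union
    (Reach.carry_natCast (m := e) (subset_affineHull (Or.inl (Or.inr rfl))))).union
    (Reach.carry hv' (subset_affineHull (Or.inr rfl)))
  set S₂ := ({fun x => (Y (c x) (a x) (b x) : ℝ)} : Set (X → ℝ)) ∪ {fun x => (e x : ℝ)} ∪ {v}
  have l₃ := Reach.bits hv (e := e) (ℓ * g) (S := S₂) (acc := fun _ => 0) (C := 0) (θ := θ')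
    (ω := fun t => (1 / 2) ^ (t % g + 1)) (κ := fun t => t / g) (fun t x => hθ _ _)
    (fun _ => le_rfl) (affineHull_const 0) (subset_affineHull (Or.inr rfl))
    (subset_affineHull (Or.inl (Or.inr rfl))) (subset_affineHull (Or.inl (Or.inl rfl)))
  have l := ((l₁.mono_width (W' := 8 * n + 10) (by rw [Finset.card_range]; omega)).trans
    (l₂.mono_width (by omega))).trans (l₃.mono_width (by omega))
  refine l.mono_right (Set.singleton_subset_iff.2 ?_)
  refine affineHull_congr (affineHull_sub (affineHull_mul 2 (subset_affineHull (Or.inl rfl)))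
    (affineHull_mul (∑ j ∈ Finset.range g, (1 / 2) ^ (j + 1))
      (subset_affineHull (Or.inr rfl)))) fun x => ?_
  have h := sum_range_mul_div_mod ℓ g fun i j => (1 / 2 : ℝ) ^ (j + 1) *
    (v x * (θ j (a x, b x, c x, i) * indEq i e x))
  have h' : ∀ i ∈ Finset.range ℓ, ∑ j ∈ Finset.range g, (1 / 2 : ℝ) ^ (j + 1) *
      (v x * (θ j (a x, b x, c x, i) * indEq i e x)) = if e x = i then
        ∑ j ∈ Finset.range g, (1 / 2 : ℝ) ^ (j + 1) * (v x * θ j (a x, b x, c x, i)) else 0 := by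
    intro i _
    unfold indEq
    split_ifs <;> simp
  rw [Finset.sum_congr rfl h', Finset.sum_ite_eq, if_pos (Finset.mem_range.2 (he x))] at h
  simp only [hθ']
  rw [h, zero_add, Finset.mul_sum, Finset.sum_mul, ← Finset.sum_sub_distrib]
  refine Finset.sum_congr rfl fun j _ => ?_
  ring

/-- The product of a monomial in the positions inside a grid cell with a number whose signed bits
depend on the cell. -/
theorem Reach.coeff_mul_monomial {d n ℓ s g K₁ K₂ : ℕ} (hd : 0 < d) (hn : 0 < n)
    (hg : 0 < g) (h₁ : 0 < K₁) (h₁n : K₁ ^ d ≤ n) (h₂ : 0 < K₂) (h₂ℓ : K₂ ^ d ≤ ℓ)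
    {z : Fin d → X → ℝ} {k : Fin d → X → ℕ} (hz : ∀ i, NearFloor (z i) (k i))
    (hzS : ∀ i, z i ∈ affineHull S)
    (hk : ∀ i x, k i x < (4 * n) ^ (s * g) * K₂ * K₂ * K₁ * K₁)
    {l : List (Fin d)} (hl : l.length < s) {θ : ℕ → X → ℕ} (hθ : ∀ j x, θ j x ≤ 1)
    (hθk : ∀ j x x', (∀ i, k i x / (4 * n) ^ (s * g) = k i x' / (4 * n) ^ (s * g)) →
      θ j x = θ j x') :
    Reach (17 * d * (n + 2)) (18 * s ^ 2 * (ℓ + 2) * g - 1) S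
      {fun x => ∑ j ∈ Finset.range g, (1 / 2) ^ (j + 1) * (2 * (θ j x : ℝ) - 1) *
        (l.map fun i => signedFraction ((4 * n) ^ (s * g)) (k i x % (4 * n) ^ (s * g))).prod} := by
  set P := (4 * n) ^ (s * g) with hP
  have hP0 : 0 < P := by positivity
  choose r hr hrS using fun i => Reach.digits (hz i) (hzS i) h₁ h₂ hP0 (hk i)
  set A : Fin d → X → ℕ := fun i x => k i x / (P * K₂ * K₂ * K₁) with hA
  set B : Fin d → X → ℕ := fun i x => k i x % (P * K₂ * K₂ * K₁) / (P * K₂ * K₂) with hB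
  set C : Fin d → X → ℕ := fun i x => k i x % (P * K₂ * K₂) / (P * K₂) with hC
  set E : Fin d → X → ℕ := fun i x => k i x % (P * K₂) / P with hE
  have hA' : ∀ x i, A i x < K₁ := fun x i => Nat.div_lt_of_lt_mul (hk i x)
  have hB' : ∀ x i, B i x < K₁ := fun x i =>
    Nat.div_lt_of_lt_mul (Nat.mod_lt _ (by positivity))
  have hC' : ∀ x i, C i x < K₂ := fun x i =>
    Nat.div_lt_of_lt_mul (Nat.mod_lt _ (by positivity))
  have hE' : ∀ x i, E i x < K₂ := fun x i =>
    Nat.div_lt_of_lt_mul (Nat.mod_lt _ (by positivity))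
  set a : X → ℕ := fun x => radixCode K₁ fun i => A i x
  set b : X → ℕ := fun x => radixCode K₁ fun i => B i x
  set c : X → ℕ := fun x => radixCode K₂ fun i => C i x
  set e : X → ℕ := fun x => radixCode K₂ fun i => E i x
  have l₁ := Reach.iUnion hrS
  rw [Fintype.card_fin] at l₁
  set S₁ : Set (X → ℝ) := ⋃ i, {fun x => (A i x : ℝ), fun x => (B i x : ℝ), fun x => (C i x : ℝ),
    fun x => (E i x : ℝ), r i}
  have code : ∀ (K : ℕ) (D : Fin d → X → ℕ), (∀ i, (fun x => (D i x : ℝ)) ∈ S₁) →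
      (fun x => (radixCode K (fun i => D i x) : ℝ)) ∈ affineHull S₁ := by
    intro K D hD
    refine affineHull_congr (affineHull_sum (I := (Finset.univ : Finset (Fin d))) fun i _ =>
      affineHull_mul ((K : ℝ) ^ (i : ℕ)) (subset_affineHull (hD i))) fun x => ?_
    simp only [radixCode]
    push_cast
    exact Finset.sum_congr rfl fun i _ => mul_comm _ _
  have aS := code K₁ A fun i => Set.mem_iUnion.2 ⟨i, Or.inl rfl⟩
  have bS := code K₁ B fun i => Set.mem_iUnion.2 ⟨i, Or.inr (Or.inl rfl)⟩
  have cS := code K₂ C fun i => Set.mem_iUnion.2 ⟨i, Or.inr (Or.inr (Or.inl rfl))⟩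
  have eS := code K₂ E fun i => Set.mem_iUnion.2 ⟨i, Or.inr (Or.inr (Or.inr (Or.inl rfl)))⟩
  have l₂ := ((((Reach.monomial (S := S₁) (B := 4 * n) (T := s * g) (by omega) hr
    (fun i x => Nat.mod_lt _ hP0) l fun i => subset_affineHull (Set.mem_iUnion.2
      ⟨i, Or.inr (Or.inr (Or.inr (Or.inr rfl)))⟩)).union (Reach.carry_natCast aS)).union
    (Reach.carry_natCast bS)).union (Reach.carry_natCast cS)).union (Reach.carry_natCast eS)
  rw [Fintype.card_fin] at l₂
  set q : X → ℕ × ℕ × ℕ × ℕ := fun x => (a x, b x, c x, e x) with hq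
  -- The bits depend only on the cell, hence only on the four codes, and can be tabulated. The
  -- minimum with 1 bounds the table on codes that do not occur, too.
  have factor : ∀ j x, min 1 (Function.extend q (θ j) 0 (q x)) = θ j x := by
    intro j x
    have hf : Function.FactorsThrough (θ j) q := by
      intro x x' hxx'
      refine hθk j x x' fun i => ?_
      simp only [hq, Prod.mk.injEq] at hxx'
      obtain ⟨h1, h2, h3, h4⟩ := hxx'
      have h1 := congrFun (radixCode_inj (hA' x) (hA' x') h1) i
      have h2 := congrFun (radixCode_inj (hB' x) (hB' x') h2) i
      have h3 := congrFun (radixCode_inj (hC' x) (hC' x') h3) i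
      have h4 := congrFun (radixCode_inj (hE' x) (hE' x') h4) i
      have expand : ∀ x, k i x / P = (A i x * K₁ + B i x) * (K₂ * K₂) + C i x * K₂ + E i x := by
        intro x
        simp only [hA, hB, hC, hE]
        simp only [Nat.mod_mul_right_div_self]
        simp only [← Nat.div_div_eq_div_mul]
        rw [Nat.div_add_mod', ← mul_assoc, ← add_mul, Nat.div_add_mod', Nat.div_add_mod']
      rw [expand, expand, h1, h2, h3, h4]
    rw [hf.extend_apply, min_eq_right (hθ j x)]
  set v : X → ℝ := fun x => (l.map fun i => signedFraction P (k i x % P)).prod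
  have l₃ := Reach.signed_bits (g := g) (v := v)
    (S := {v} ∪ {fun x => (a x : ℝ)} ∪ {fun x => (b x : ℝ)} ∪ {fun x => (c x : ℝ)} ∪
      {fun x => (e x : ℝ)}) (a := a) (b := b) (c := c) (e := e)
    (fun x => (radixCode_lt (hA' x)).trans_le h₁n) (fun x => (radixCode_lt (hB' x)).trans_le h₁n)
    (fun x => (radixCode_lt (hC' x)).trans_le h₂ℓ) (fun x => (radixCode_lt (hE' x)).trans_le h₂ℓ)
    (fun x => abs_prod_signedFraction_le (fun i => Nat.mod_lt (k i x) hP0) l)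
    (θ := fun j p => min 1 (Function.extend q (θ j) 0 p)) (fun j p => min_le_left _ _)
    (subset_affineHull (Or.inl (Or.inl (Or.inl (Or.inr rfl)))))
    (subset_affineHull (Or.inl (Or.inl (Or.inr rfl))))
    (subset_affineHull (Or.inl (Or.inr rfl))) (subset_affineHull (Or.inr rfl))
    (subset_affineHull (Or.inl (Or.inl (Or.inl (Or.inl rfl)))))
  have hK₁n : K₁ ≤ n := (Nat.le_self_pow hd.ne' K₁).trans h₁n
  have hK₂ℓ : K₂ ≤ ℓ := (Nat.le_self_pow hd.ne' K₂).trans h₂ℓ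
  have w : 17 * n + 34 * d ≤ 17 * d * (n + 2) := by nlinarith
  have w₁ : d * (2 * K₁ + 7) ≤ 17 * d * (n + 2) := by nlinarith
  have l₄ := ((l₁.mono_width w₁).trans (l₂.mono_width (by omega))).trans (l₃.mono_width (by omega))
  have l' := l₄.mono_right (S' := {fun x => ∑ j ∈ Finset.range g,
    (1 / 2) ^ (j + 1) * (2 * (θ j x : ℝ) - 1) *
        (l.map fun i => signedFraction P (k i x % P)).prod})
    (Set.singleton_subset_iff.2 (affineHull_congr (subset_affineHull rfl) fun x => ?_))
  -- Monomials of different degree need different depths; padding to a common depth lets them run in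
  -- parallel. One layer less than the stated budget is used, leaving room for the clamping of the
  -- inputs.
  · refine l'.pad (by omega) (Nat.le_sub_one_of_lt ?_)
    obtain ⟨s, rfl⟩ : ∃ s', s = s' + 1 := ⟨s - 1, by omega⟩
    have e1 : 2 * ((s + 1) * g) * l.length ≤ 2 * ((s + 1) * g) * s :=
      Nat.mul_le_mul_left _ (by omega)
    have e2 : (ℓ + 2) * (s + 1) ^ 2 ≤ (ℓ + 2) * (s + 1) ^ 2 * g := Nat.le_mul_of_pos_right _ hg
    nlinarith [Nat.zero_le (ℓ * s * g), Nat.zero_le (ℓ * s ^ 2 * g), Nat.zero_le (s * g),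
      Nat.zero_le (s ^ 2 * g), Nat.zero_le (ℓ * g), Nat.zero_le (ℓ * s), Nat.zero_le (ℓ * s ^ 2)]
  · refine Finset.sum_congr rfl fun j _ => ?_
    rw [factor j x]

end Monomial

/-! ### Taylor expansion on the cube -/

theorem unitCube_subset_closure_interior (d : ℕ) :
    unitCube d ⊆ closure (interior (unitCube d)) := by
  have hne : (interior (unitCube d)).Nonempty := by
    refine ⟨fun _ => 1 / 2, mem_interior.2 ⟨Set.univ.pi fun _ => Set.Ioo 0 1, ?_, ?_, ?_⟩⟩
    · intro x hx
      exact ⟨fun i => (hx i trivial).1.le, fun i => (hx i trivial).2.le⟩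
    · exact isOpen_set_pi Set.finite_univ fun _ _ => isOpen_Ioo
    · intro i _
      norm_num
  exact subset_closure.trans
    ((convex_Icc (𝕜 := ℝ) (0 : Fin d → ℝ) 1).closure_interior_eq_closure_of_nonempty_interior hne).ge

/-- The cube lies in the closure of its interior, so an almost everywhere bound on a continuous
function holds at every point, boundary included. -/
theorem abs_le_of_linftyNorm_le {d : ℕ} {g : (Fin d → ℝ) → ℝ} (hg : ContinuousOn g (unitCube d))
    {A : ℝ} (hA : 0 ≤ A) (h : linftyNorm g ≤ ENNReal.ofReal A) {x : Fin d → ℝ}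
    (hx : x ∈ unitCube d) : |g x| ≤ A := by
  have h1 : ∀ᵐ x ∂volume.restrict (unitCube d), |g x| ≤ A := by
    rw [linftyNorm, eLpNorm_exponent_top] at h
    filter_upwards [enorm_ae_le_eLpNormEssSup g (volume.restrict (unitCube d))] with x hx
    have := hx.trans h
    rwa [← ofReal_norm, ENNReal.ofReal_le_ofReal_iff hA] at this
  -- The inequality is recast as the equation `max |g| A = A`, since the continuity principle
  -- applies to almost everywhere equalities.
  have h2 : (fun x => max |g x| A) =ᵐ[volume.restrict (unitCube d)] fun _ => A := by
    filter_upwards [h1] with x hx using max_eq_right hx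
  have := Measure.eqOn_of_ae_eq h2 (hg.abs.sup continuousOn_const) continuousOn_const
    (unitCube_subset_closure_interior d) hx
  exact max_eq_right_iff.1 this

theorem abs_multiPartialDeriv_le {d s : ℕ} {f : (Fin d → ℝ) → ℝ}
    (hf : ContDiffOn ℝ s f (unitCube d)) {α : Fin d → ℕ} (hα : ∑ i, α i ≤ s) {x : Fin d → ℝ}
    (hx : x ∈ unitCube d) : |multiPartialDeriv α f x| ≤ (csNorm s f).toReal := by
  refine abs_le_of_linftyNorm_le (contDiffOn_multiPartialDeriv hf hα).continuousOn
    ENNReal.toReal_nonneg ?_ hx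
  rw [ENNReal.ofReal_toReal (csNorm_lt_top hf).ne]
  exact le_iSup₂ (f := fun α (_ : α ∈ {α : Fin d → ℕ | ∑ i, α i ≤ s}) =>
    linftyNorm (multiPartialDeriv α f)) α hα

/-- Induction on the order: the derivative of the remainder is the remainder of one order less for
the shifted sequence, and the mean value inequality supplies the missing factor `|x - y|`. The
factorial gain is discarded. -/
theorem abs_sub_taylor_le (n : ℕ) {A : ℝ} : ∀ {g : ℕ → ℝ → ℝ}, (∀ k < n, ∀ t ∈ Set.Icc (0 : ℝ) 1,
      HasDerivWithinAt (g k) (g (k + 1) t) (Set.Icc 0 1) t) →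
    (∀ t ∈ Set.Icc (0 : ℝ) 1, |g n t| ≤ A) → ∀ {x y : ℝ}, x ∈ Set.Icc (0 : ℝ) 1 →
    y ∈ Set.Icc (0 : ℝ) 1 →
    |g 0 x - ∑ k ∈ Finset.range n, g k y * ((x - y) ^ k / k.factorial)| ≤ A * |x - y| ^ n := by
  induction n with
  | zero => intro g _ hA x y hx _; simpa using hA x hx
  | succ n ih =>
    intro g hg hA x y hx hy
    set D : ℝ → ℝ := fun u => g 0 u -
      ∑ k ∈ Finset.range (n + 1), g k y * ((u - y) ^ k / k.factorial) with hD
    set D' : ℝ → ℝ := fun u => g 1 u -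
      ∑ k ∈ Finset.range n, g (k + 1) y * ((u - y) ^ k / k.factorial) with hD'
    have hsub : Set.uIcc y x ⊆ Set.Icc 0 1 := Set.OrdConnected.uIcc_subset inferInstance hy hx
    have hA0 : 0 ≤ A := (abs_nonneg _).trans (hA x hx)
    have h1 : ∀ u ∈ Set.uIcc y x, HasDerivWithinAt D (D' u) (Set.uIcc y x) u := by
      intro u hu
      have h2 := (hg 0 (by omega) u (hsub hu)).mono hsub
      refine h2.sub ?_
      simp only [Finset.sum_range_succ' _ n]
      have h3 : ∀ k ∈ Finset.range n, HasDerivWithinAt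
          (fun u => g (k + 1) y * ((u - y) ^ (k + 1) / (k + 1).factorial))
          (g (k + 1) y * ((u - y) ^ k / k.factorial)) (Set.uIcc y x) u := by
        intro k _
        have h4 : HasDerivAt (fun u : ℝ => (u - y) ^ (k + 1) / (k + 1).factorial)
            (((k + 1 : ℕ) * (u - y) ^ (k + 1 - 1) * 1) / (k + 1).factorial) u :=
          (((hasDerivAt_id u).sub_const y).pow (k + 1)).div_const _
        refine (h4.const_mul _).hasDerivWithinAt.congr_deriv ?_
        have h5 : ((k + 1 : ℕ) : ℝ) ≠ 0 := by positivity
        have h6 : (k.factorial : ℝ) ≠ 0 := by positivity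
        rw [Nat.factorial_succ, Nat.add_sub_cancel]
        push_cast at h5 ⊢
        field_simp
      simpa using (HasDerivWithinAt.fun_sum h3).add_const (g 0 y)
    have h2 : ∀ u ∈ Set.uIcc y x, ‖D' u‖ ≤ A * |x - y| ^ n := by
      intro u hu
      refine (ih (g := fun k => g (k + 1)) (fun k hk => hg (k + 1) (by omega)) hA
        (hsub hu) hy).trans ?_
      exact mul_le_mul_of_nonneg_left
        (pow_le_pow_left₀ (abs_nonneg _) (Set.abs_sub_left_of_mem_uIcc hu) n) hA0
    have h3 := (convex_uIcc y x).norm_image_sub_le_of_norm_hasDerivWithin_le h1 h2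
      Set.left_mem_uIcc Set.right_mem_uIcc
    have h4 : D y = 0 := by
      simp [hD, Finset.sum_range_succ']
    rwa [h4, sub_zero, Real.norm_eq_abs, Real.norm_eq_abs, mul_assoc, ← pow_succ] at h3

/-! ### Taylor expansion one coordinate at a time. -/

theorem update_mem_unitCube {d : ℕ} {y : Fin d → ℝ} (hy : y ∈ unitCube d) (i : Fin d) {t : ℝ}
    (ht : t ∈ Set.Icc (0 : ℝ) 1) : Function.update y i t ∈ unitCube d := by
  constructor <;> intro j <;> by_cases hj : j = i
  · subst hj; simpa using ht.1
  · simpa [hj] using hy.1 j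
  · subst hj; simpa using ht.2
  · simpa [hj] using hy.2 j

theorem hasDerivWithinAt_update {d : ℕ} {g : (Fin d → ℝ) → ℝ}
    (hg : DifferentiableOn ℝ g (unitCube d)) (i : Fin d) {y : Fin d → ℝ} (hy : y ∈ unitCube d)
    {t : ℝ} (ht : t ∈ Set.Icc (0 : ℝ) 1) :
    HasDerivWithinAt (fun u => g (Function.update y i u))
      (partialDeriv i g (Function.update y i t)) (Set.Icc 0 1) t := by
  have hm := update_mem_unitCube hy i ht
  rw [partialDeriv_eq hg i hm]
  exact (hg _ hm).hasFDerivWithinAt.comp_hasDerivWithinAt t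
    (hasDerivAt_update y i t).hasDerivWithinAt fun u hu => update_mem_unitCube hy i hu

theorem contDiffOn_iterate_partialDeriv {d : ℕ} (i : Fin d) (k : ℕ) :
    ∀ {n : ℕ} {g : (Fin d → ℝ) → ℝ}, ContDiffOn ℝ (n + k : ℕ) g (unitCube d) →
      ContDiffOn ℝ n ((partialDeriv i)^[k] g) (unitCube d) := by
  induction k with
  | zero => intro n g hg; simpa using hg
  | succ k ih =>
    intro n g hg
    rw [Function.iterate_succ_apply]
    exact ih (contDiffOn_partialDeriv (n := n + k) hg i)

/-- The factors of `∂^α` in directions with exponent `0` may be dropped. -/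
theorem foldr_partialDeriv_eq {d : ℕ} {α : Fin d → ℕ} {f : (Fin d → ℝ) → ℝ} {l l' : List (Fin d)}
    (h : l.Sublist l') (hl' : l'.Nodup) (hα : ∀ j, j ∉ l → α j = 0) :
    l'.foldr (fun i h => (partialDeriv i)^[α i] h) f =
      l.foldr (fun i h => (partialDeriv i)^[α i] h) f := by
  replace hα : ∀ j ∈ l', j ∉ l → α j = 0 := fun j _ => hα j
  induction h with
  | slnil => rfl
  | @cons l₁ l₂ i h ih =>
    rw [List.nodup_cons] at hl'
    rw [List.foldr_cons, hα i (by simp) fun hi => hl'.1 (h.subset hi), Function.iterate_zero_apply]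
    exact ih hl'.2 fun j hj => hα j (by simp [hj])
  | @cons_cons l₁ l₂ i h ih =>
    rw [List.nodup_cons] at hl'
    rw [List.foldr_cons, List.foldr_cons, ih hl'.2 fun j hj hj' => hα j (by simp [hj]) ?_]
    rw [List.mem_cons, not_or]
    exact ⟨fun h => hl'.1 (by rwa [← h]), hj'⟩

/-- As `i` precedes `l` in the order of differentiation and `α` vanishes off `l`, the new
derivatives are already outermost. Thus symmetry of mixed partial derivatives is never needed. -/
theorem iterate_multiPartialDeriv {d : ℕ} {α : Fin d → ℕ} (f : (Fin d → ℝ) → ℝ) {i : Fin d}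
    {l : List (Fin d)} (h : (i :: l).Sublist (List.finRange d)) (hα : ∀ j, j ∉ l → α j = 0)
    (a : ℕ) : (partialDeriv i)^[a] (multiPartialDeriv α f) =
      multiPartialDeriv (Function.update α i a) f := by
  have hi : i ∉ l := (List.nodup_cons.1 (h.nodup (List.nodup_finRange d))).1
  rw [multiPartialDeriv, multiPartialDeriv,
    foldr_partialDeriv_eq (List.sublist_of_cons_sublist h) (List.nodup_finRange d) hα,
    foldr_partialDeriv_eq h (List.nodup_finRange d), List.foldr_cons, Function.update_self]
  · congr 1
    refine List.foldr_ext _ _ _ fun j hj g => ?_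
    rw [Function.update_of_ne fun h => hi (by rwa [← h])]
  · intro j hj
    rw [List.mem_cons, not_or] at hj
    rw [Function.update_of_ne hj.1, hα j hj.2]

theorem prod_update_apply {ι M : Type*} [Fintype ι] [DecidableEq ι] [CommMonoid M] (F : ι → ℕ → M)
    {α : ι → ℕ} {i : ι} (hi : F i (α i) = 1) (a : ℕ) :
    ∏ j, F j (Function.update α i a j) = F i a * ∏ j, F j (α j) := by
  rw [← Finset.mul_prod_erase _ _ (Finset.mem_univ i),
    ← Finset.mul_prod_erase _ (fun j => F j (α j)) (Finset.mem_univ i), hi, one_mul,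
    Function.update_self]
  congr 1
  refine Finset.prod_congr rfl fun j hj => ?_
  rw [Function.update_of_ne (Finset.ne_of_mem_erase hj)]

theorem sum_update_of_eq_zero {d : ℕ} {α : Fin d → ℕ} {i : Fin d} (hi : α i = 0) (a : ℕ) :
    ∑ j, Function.update α i a j = a + ∑ j, α j := by
  rw [Finset.sum_update_of_mem (Finset.mem_univ i),
    ← Finset.add_sum_erase _ α (Finset.mem_univ i), hi, zero_add, Finset.sdiff_singleton_eq_erase]

theorem abs_monomial_le {d : ℕ} {x y : Fin d → ℝ} {ρ : ℝ} (h : ∀ j, |x j - y j| ≤ ρ)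
    (α : Fin d → ℕ) :
    |∏ j, (x j - y j) ^ α j / (α j).factorial| ≤ ρ ^ ∑ j, α j := by
  rw [Finset.abs_prod, ← Finset.prod_pow_eq_pow_sum]
  refine Finset.prod_le_prod (fun _ _ => abs_nonneg _) fun j _ => ?_
  rw [abs_div, abs_pow, Nat.abs_cast]
  have h1 : (1 : ℝ) ≤ (α j).factorial := by exact_mod_cast Nat.one_le_iff_ne_zero.2 (Nat.factorial_ne_zero _)
  refine (div_le_self (by positivity) h1).trans ?_
  exact pow_le_pow_left₀ (abs_nonneg _) (h j) _

/-- Induction on the coordinates in which `x` and `y` may differ. After the expansion in the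
coordinates of `l`, each coefficient `∂^α f` is expanded in `x i` to order `s - |α|`; its remainder
times the monomial of degree `|α|` is again of order `ρ ^ s`. -/
theorem exists_taylor_along {d s : ℕ} (hs : 0 < s) {f : (Fin d → ℝ) → ℝ}
    (hf : ContDiffOn ℝ s f (unitCube d)) {l : List (Fin d)} (hl : l.Sublist (List.finRange d)) :
    ∃ (ι : Type) (_ : Fintype ι) (α : ι → Fin d → ℕ), Fintype.card ι ≤ s ^ l.length ∧
      (∀ t, ∑ i, α t i < s) ∧ (∀ t, ∀ j, j ∉ l → α t j = 0) ∧
      ∀ {ρ : ℝ} {x y : Fin d → ℝ}, 0 ≤ ρ → x ∈ unitCube d → y ∈ unitCube d →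
        (∀ j, j ∉ l → x j = y j) → (∀ j, |x j - y j| ≤ ρ) →
        |f x - ∑ t, multiPartialDeriv (α t) f y *
          ∏ j, (x j - y j) ^ α t j / (α t j).factorial| ≤
          (csNorm s f).toReal * (s + 1) ^ l.length * ρ ^ s := by
  have hA : 0 ≤ (csNorm s f).toReal := ENNReal.toReal_nonneg
  induction l with
  | nil =>
    refine ⟨Unit, inferInstance, fun _ _ => 0, by simp, by simpa, by simp, ?_⟩
    intro ρ x y hρ _ _ hxy _
    have : x = y := funext fun j => hxy j (by simp)
    have h0 : multiPartialDeriv (fun _ => 0) f = f := by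
      rw [multiPartialDeriv, foldr_partialDeriv_eq (List.nil_sublist _) (List.nodup_finRange d)
        fun _ _ => rfl]
      rfl
    simp only [this, h0, sub_self, pow_zero, Nat.factorial_zero, Nat.cast_one, div_one,
      Finset.prod_const_one, mul_one, Finset.univ_unique, Finset.sum_const, Finset.card_singleton,
      one_smul, abs_zero]
    positivity
  | cons i l ih =>
    have hi : i ∉ l := (List.nodup_cons.1 (hl.nodup (List.nodup_finRange d))).1
    obtain ⟨ι, _, α, hcard, hα, hsupp, hbound⟩ := ih (List.sublist_of_cons_sublist hl)
    refine ⟨Σ t : ι, Fin (s - ∑ j, α t j), inferInstance, fun t => Function.update (α t.1) i t.2,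
      ?_, ?_, ?_, ?_⟩
    · rw [Fintype.card_sigma, List.length_cons, pow_succ]
      refine (Finset.sum_le_card_nsmul _ _ s fun t _ => ?_).trans (Nat.mul_le_mul_right s hcard)
      simp
    · rintro ⟨t, a⟩
      have h1 := a.2
      have h2 := sum_update_of_eq_zero (hsupp t i hi) (a : ℕ)
      simp only at h2 ⊢
      omega
    · rintro ⟨t, a⟩ j hj
      rw [List.mem_cons, not_or] at hj
      simp only
      rw [Function.update_of_ne hj.1, hsupp t j hj.2]
    · intro ρ x y hρ hx hy hxy hdist
      -- The intermediate point differs from `x` only in coordinates of `l`, and from `y` only in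
      -- coordinate `i`.
      set y' := Function.update y i (x i) with hy'
      have hy'mem : y' ∈ unitCube d := update_mem_unitCube hy i ⟨hx.1 i, hx.2 i⟩
      have hxy' : ∀ j, j ∉ l → x j = y' j := by
        intro j hj
        by_cases hji : j = i
        · subst hji; simp [hy']
        · rw [hy', Function.update_of_ne hji]
          exact hxy j (by simp [hji, hj])
      have hdist' : ∀ j, |x j - y' j| ≤ ρ := by
        intro j
        by_cases hji : j = i
        · subst hji; simpa [hy'] using hρ
        · rw [hy', Function.update_of_ne hji]
          exact hdist j
      have h1 := hbound hρ hx hy'mem hxy' hdist'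
      set m : ι → ℝ := fun t => ∏ j, (x j - y j) ^ α t j / (α t j).factorial with hm
      have hm' : ∀ t, ∏ j, (x j - y' j) ^ α t j / (α t j).factorial = m t := by
        intro t
        refine Finset.prod_congr rfl fun j _ => ?_
        by_cases hji : j = i
        · subst hji; simp [hsupp t j hi]
        · rw [hy', Function.update_of_ne hji]
      simp only [hm'] at h1
      have h2 : ∀ t, |multiPartialDeriv (α t) f y' - ∑ a ∈ Finset.range (s - ∑ j, α t j),
          multiPartialDeriv (Function.update (α t) i a) f y *
            ((x i - y i) ^ a / a.factorial)| ≤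
          (csNorm s f).toReal * |x i - y i| ^ (s - ∑ j, α t j) := by
        intro t
        have h3 := abs_sub_taylor_le (s - ∑ j, α t j) (A := (csNorm s f).toReal)
          (g := fun a u => (partialDeriv i)^[a] (multiPartialDeriv (α t) f)
            (Function.update y i u)) ?_ ?_ ⟨hx.1 i, hx.2 i⟩ ⟨hy.1 i, hy.2 i⟩
        · simpa only [Function.iterate_zero_apply, Function.update_eq_self, ← hy',
            ← iterate_multiPartialDeriv f hl (hsupp t)] using h3
        · intro a ha u hu
          rw [Function.iterate_succ_apply']
          refine hasDerivWithinAt_update (ContDiffOn.differentiableOn (n := 1)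
            (contDiffOn_iterate_partialDeriv i a ?_) one_ne_zero) i hy hu
          refine (contDiffOn_multiPartialDeriv hf (hα t).le).of_le ?_
          exact_mod_cast (by omega : 1 + a ≤ s - ∑ j, α t j)
        · intro u hu
          simp only [iterate_multiPartialDeriv f hl (hsupp t)]
          refine abs_multiPartialDeriv_le hf ?_ (update_mem_unitCube hy i hu)
          rw [sum_update_of_eq_zero (hsupp t i hi)]
          have := hα t
          omega
      have h3 : ∑ t : Σ t : ι, Fin (s - ∑ j, α t j),
          multiPartialDeriv (Function.update (α t.1) i t.2) f y *
            ∏ j, (x j - y j) ^ Function.update (α t.1) i (t.2 : ℕ) j /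
              (Function.update (α t.1) i (t.2 : ℕ) j).factorial =
          ∑ t, (∑ a ∈ Finset.range (s - ∑ j, α t j),
            multiPartialDeriv (Function.update (α t) i a) f y *
              ((x i - y i) ^ a / a.factorial)) * m t := by
        rw [Fintype.sum_sigma]
        refine Finset.sum_congr rfl fun t _ => ?_
        rw [Finset.sum_mul, ← Fin.sum_univ_eq_sum_range (fun a =>
          multiPartialDeriv (Function.update (α t) i a) f y *
              ((x i - y i) ^ a / a.factorial) * m t)]
        refine Finset.sum_congr rfl fun a _ => ?_
        rw [prod_update_apply (fun j b => (x j - y j) ^ b / (b.factorial : ℝ))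
          (by simp [hsupp t i hi]), mul_assoc]
      simp only
      rw [h3]
      have h4 : |∑ t, multiPartialDeriv (α t) f y' * m t -
          ∑ t, (∑ a ∈ Finset.range (s - ∑ j, α t j),
            multiPartialDeriv (Function.update (α t) i a) f y *
              ((x i - y i) ^ a / a.factorial)) * m t| ≤
          (csNorm s f).toReal * s ^ l.length * ρ ^ s := by
        rw [← Finset.sum_sub_distrib]
        refine (Finset.abs_sum_le_sum_abs _ _).trans ?_
        refine (Finset.sum_le_card_nsmul _ _ ((csNorm s f).toReal * ρ ^ s) fun t _ => ?_).trans ?_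
        · rw [← sub_mul, abs_mul]
          have e : ρ ^ s = ρ ^ (s - ∑ j, α t j) * ρ ^ ∑ j, α t j := by
            rw [← pow_add, Nat.sub_add_cancel (hα t).le]
          rw [e, ← mul_assoc]
          refine mul_le_mul ((h2 t).trans ?_) (abs_monomial_le hdist _) (abs_nonneg _)
            (by positivity)
          gcongr
          exact hdist i
        · rw [nsmul_eq_mul, Finset.card_univ]
          have : (Fintype.card ι : ℝ) ≤ (s : ℝ) ^ l.length := by exact_mod_cast hcard
          have h0 : 0 ≤ (csNorm s f).toReal * ρ ^ s := by positivity
          nlinarith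
      have h5 := abs_sub_le (f x) (∑ t, multiPartialDeriv (α t) f y' * m t)
        (∑ t, (∑ a ∈ Finset.range (s - ∑ j, α t j),
            multiPartialDeriv (Function.update (α t) i a) f y *
              ((x i - y i) ^ a / a.factorial)) * m t)
      refine h5.trans ((add_le_add h1 h4).trans ?_)
      have h6 : (s : ℝ) ^ l.length ≤ (s + 1) ^ l.length := by gcongr; linarith
      have h7 : (1 : ℝ) ≤ s := by exact_mod_cast hs
      -- The old error, plus one remainder for each of at most `s ^ l.length` old terms, fits the
      -- new constant.
      have h8 : (s + 1 : ℝ) ^ l.length + s ^ l.length ≤ (s + 1) ^ (i :: l).length := by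
        rw [List.length_cons, pow_succ]
        have : (0 : ℝ) < (s + 1) ^ l.length := by positivity
        nlinarith
      rw [← add_mul, ← mul_add]
      gcongr

theorem csNorm_mono {d s s' : ℕ} (h : s ≤ s') (f : (Fin d → ℝ) → ℝ) :
    csNorm s f ≤ csNorm s' f :=
  biSup_mono fun _ hα => le_trans (show _ ≤ s from hα) h

/-- Changing the coordinates in `l` by at most `ρ` changes `f` by at most `‖f‖ 2 ^ |l| ρ`. -/
theorem abs_sub_le_of_contDiffOn {d s : ℕ} (hs : 0 < s) {f : (Fin d → ℝ) → ℝ}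
    (hf : ContDiffOn ℝ s f (unitCube d)) {l : List (Fin d)} (hl : l.Sublist (List.finRange d))
    {ρ : ℝ} {x y : Fin d → ℝ} (hρ : 0 ≤ ρ) (hx : x ∈ unitCube d) (hy : y ∈ unitCube d)
    (hxy : ∀ j, j ∉ l → x j = y j) (hdist : ∀ j, |x j - y j| ≤ ρ) :
    |f x - f y| ≤ (csNorm s f).toReal * 2 ^ l.length * ρ := by
  have hf1 : ContDiffOn ℝ (1 : ℕ) f (unitCube d) := hf.of_le (by exact_mod_cast hs)
  obtain ⟨ι, _, α, -, hα, -, hb⟩ := exists_taylor_along one_pos hf1 hl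
  have hα0 : ∀ t, α t = fun _ => 0 := by
    intro t
    have := Nat.lt_one_iff.1 (hα t)
    rw [Finset.sum_eq_zero_iff] at this
    exact funext fun j => this j (Finset.mem_univ j)
  have h1 := hb hρ hx hy hxy hdist
  -- At `x = y` with `ρ = 0` the expansion is exact, which identifies the sum of constant terms as
  -- `f y` whatever their number.
  have h2 := hb (ρ := 0) le_rfl hy hy (fun _ _ => rfl) (by simp)
  simp only [hα0, pow_zero, Nat.factorial_zero, Nat.cast_one, div_one, Finset.prod_const_one,
    mul_one, pow_one, mul_zero, abs_nonpos_iff, sub_eq_zero] at h1 h2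
  rw [← h2, one_add_one_eq_two] at h1
  refine h1.trans ?_
  gcongr
  · exact (csNorm_lt_top hf).ne
  · exact csNorm_mono hs f

/-! ### Removal of the bad points by medians of shifted copies -/

section Comp

variable {X Y : Type*} {S S' : Set (X → ℝ)} {W t : ℕ}

theorem affineHull_comp {f : X → ℝ} (hf : f ∈ affineHull S) (p : Y → X) :
    f ∘ p ∈ affineHull ((· ∘ p) '' S) := by
  have h : affineHull S ≤ (affineHull ((· ∘ p) '' S)).comap (LinearMap.funLeft ℝ ℝ p) := by
    refine Submodule.span_le.2 (Set.insert_subset (affineHull_const 1) fun g hg => ?_)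
    exact subset_affineHull ⟨g, hg, rfl⟩
  exact h hf

/-- Provides the shifted copies: a translation of the input is absorbed by the first affine map. -/
theorem Reach.comp (h : Reach W t S S') (p : Y → X) :
    Reach W t ((· ∘ p) '' S) ((· ∘ p) '' S') := by
  classical
  induction t generalizing S with
  | zero =>
    rintro _ ⟨f, hf, rfl⟩
    exact affineHull_comp (h hf) p
  | succ t ih =>
    obtain ⟨S₁, ⟨G, h1, h2, h3⟩, h4⟩ := h
    refine ⟨_, ⟨G.image (· ∘ p), Finset.card_image_le.trans h1, ?_, ?_⟩, ih h4⟩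
    · intro g hg
      obtain ⟨g, hgG, rfl⟩ := Finset.mem_image.1 hg
      exact affineHull_comp (h2 g hgG) p
    · rintro _ ⟨f, hf, rfl⟩
      refine affineHull_mono ?_ (affineHull_comp (h3 hf) p)
      rintro _ ⟨_, ⟨g, hg, rfl⟩, rfl⟩
      exact ⟨g ∘ p, by simpa using ⟨g, hg, rfl⟩, rfl⟩

end Comp

/-- The median of three numbers. -/
def medianThree (a b c : ℝ) : ℝ :=
  a + b - c - max 0 (b + max 0 (a - b) - c) + max 0 (c - a + max 0 (a - b))

/-- The formula equals `a + b + c` minus the maximum and the minimum, and any interval containing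
two of three numbers contains their median. -/
theorem abs_medianThree_sub_le {a b c y ε : ℝ}
    (h : (|a - y| ≤ ε ∧ |b - y| ≤ ε) ∨ (|a - y| ≤ ε ∧ |c - y| ≤ ε) ∨ (|b - y| ≤ ε ∧ |c - y| ≤ ε)) :
    |medianThree a b c - y| ≤ ε := by
  have key : ∀ lo hi : ℝ, ((lo ≤ a ∧ a ≤ hi ∧ lo ≤ b ∧ b ≤ hi) ∨ (lo ≤ a ∧ a ≤ hi ∧ lo ≤ c ∧ c ≤ hi) ∨
      (lo ≤ b ∧ b ≤ hi ∧ lo ≤ c ∧ c ≤ hi)) → lo ≤ medianThree a b c ∧ medianThree a b c ≤ hi := by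
    intro lo hi h
    unfold medianThree
    rcases le_total 0 (a - b) with h1 | h1
    · rw [max_eq_right h1]
      rcases le_total 0 (b + (a - b) - c) with h2 | h2 <;>
        rcases le_total 0 (c - a + (a - b)) with h3 | h3 <;>
        simp only [max_eq_left, max_eq_right, h2, h3] <;>
        rcases h with ⟨_, _, _, _⟩ | ⟨_, _, _, _⟩ | ⟨_, _, _, _⟩ <;> constructor <;> linarith
    · rw [max_eq_left h1]
      rcases le_total 0 (b + 0 - c) with h2 | h2 <;>
        rcases le_total 0 (c - a + 0) with h3 | h3 <;>
        simp only [max_eq_left, max_eq_right, h2, h3] <;>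
        rcases h with ⟨_, _, _, _⟩ | ⟨_, _, _, _⟩ | ⟨_, _, _, _⟩ <;> constructor <;> linarith
  have := key (y - ε) (y + ε) (by
    simp only [abs_le] at h
    rcases h with ⟨⟨_, _⟩, _, _⟩ | ⟨⟨_, _⟩, _, _⟩ | ⟨⟨_, _⟩, _, _⟩
    · exact Or.inl ⟨by linarith, by linarith, by linarith, by linarith⟩
    · exact Or.inr (Or.inl ⟨by linarith, by linarith, by linarith, by linarith⟩)
    · exact Or.inr (Or.inr ⟨by linarith, by linarith, by linarith, by linarith⟩))
  rw [abs_le]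
  constructor <;> linarith

theorem Reach.median {X : Type*} (f g h : X → ℝ) :
    Reach 7 2 ({f} ∪ {g} ∪ {h}) {fun x => medianThree (f x) (g x) (h x)} := by
  set S := ({f} : Set (X → ℝ)) ∪ {g} ∪ {h}
  have f₀ : f ∈ affineHull S := subset_affineHull (Or.inl (Or.inl rfl))
  have g₀ : g ∈ affineHull S := subset_affineHull (Or.inl (Or.inr rfl))
  have h₀ : h ∈ affineHull S := subset_affineHull (Or.inr rfl)
  have l₁ := (((Reach.single (affineHull_sub f₀ g₀)).union (Reach.carry_two f₀ (t := 1))).union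
    (Reach.carry_two g₀)).union (Reach.carry_two h₀)
  set S₁ : Set (X → ℝ) := {relu fun x => f x - g x} ∪ {f} ∪ {g} ∪ {h}
  have r₁ : (relu fun x => f x - g x) ∈ affineHull S₁ :=
    subset_affineHull (Or.inl (Or.inl (Or.inl rfl)))
  have f₁ : f ∈ affineHull S₁ := subset_affineHull (Or.inl (Or.inl (Or.inr rfl)))
  have g₁ : g ∈ affineHull S₁ := subset_affineHull (Or.inl (Or.inr rfl))
  have h₁ : h ∈ affineHull S₁ := subset_affineHull (Or.inr rfl)
  have l₂ := ((Reach.carry_two (affineHull_sub (affineHull_add f₁ g₁) h₁) (t := 1)).union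
    (Reach.single (affineHull_sub (affineHull_add g₁ r₁) h₁))).union
    (Reach.single (affineHull_add (affineHull_sub h₁ f₁) r₁))
  refine (l₁.trans (l₂.mono_width (W' := 7) (by norm_num))).mono_right
    (Set.singleton_subset_iff.2 ?_)
  exact affineHull_congr (affineHull_add (affineHull_sub (subset_affineHull (Or.inl (Or.inl rfl)))
    (subset_affineHull (Or.inl (Or.inr rfl)))) (subset_affineHull (Or.inr rfl))) fun x => rfl

/-- If at most one of `t - τ`, `t`, `t + τ` is bad for any `t`, then a network that approximates `F`
at all points without bad coordinates gives rise to one that approximates `F` everywhere. -/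
theorem Reach.exists_uniform {d W D : ℕ} (hW : 3 ≤ W) {Bad : Set ℝ} {τ : ℝ}
    (hBad : ∀ t, (t - τ ∉ Bad ∧ t ∉ Bad) ∨ (t - τ ∉ Bad ∧ t + τ ∉ Bad) ∨ (t ∉ Bad ∧ t + τ ∉ Bad))
    {F : (Fin d → ℝ) → ℝ} {ε η : ℝ}
    (hF : ∀ x i c, |c| ≤ |τ| → |F (Function.update x i (x i + c)) - F x| ≤ η)
    {g : (Fin d → ℝ) → ℝ} (hg : Reach W D (Set.range fun i x => x i) {g})
    (hgF : ∀ x, (∀ i, x i ∉ Bad) → |g x - F x| ≤ ε) :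
    ∃ g, Reach (3 ^ d * W) (D + 2 * d) (Set.range fun (i : Fin d) (x : Fin d → ℝ) => x i) {g} ∧
      ∀ x, |g x - F x| ≤ ε + d * η := by
  -- After `m` medians the first `m` coordinates may be arbitrary; each median triples the width,
  -- adds two layers and costs one more `η` for the shift.
  suffices key : ∀ m ≤ d, ∃ g, Reach (3 ^ m * W) (D + 2 * m)
      (Set.range fun (i : Fin d) (x : Fin d → ℝ) => x i) {g} ∧
      ∀ x : Fin d → ℝ, (∀ i : Fin d, m ≤ i → x i ∉ Bad) → |g x - F x| ≤ ε + m * η by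
    obtain ⟨g, h1, h2⟩ := key d le_rfl
    exact ⟨g, h1, fun x => h2 x fun i hi => absurd i.2 (by omega)⟩
  intro m
  induction m with
  | zero => exact fun _ => ⟨g, by simpa using hg, fun x hx => by simpa using hgF x fun i => hx i (by omega)⟩
  | succ m ih =>
    intro hm
    obtain ⟨g, h1, h2⟩ := ih (by omega)
    set i : Fin d := ⟨m, hm⟩ with hi
    set p : ℝ → (Fin d → ℝ) → Fin d → ℝ := fun c x => Function.update x i (x i + c) with hp
    have hr : ∀ c, Reach (3 ^ m * W) (D + 2 * m) (Set.range fun i x => x i) {g ∘ p c} := by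
      intro c
      have h3 := h1.comp (p c)
      rw [Set.image_singleton] at h3
      refine h3.mono_left ?_
      rintro _ ⟨_, ⟨j, rfl⟩, rfl⟩
      by_cases hj : j = i
      · refine affineHull_congr (affineHull_add (subset_affineHull ⟨i, rfl⟩) (affineHull_const c))
          fun x => ?_
        simp [hp, hj]
      · refine affineHull_congr (subset_affineHull ⟨j, rfl⟩) fun x => ?_
        simp [hp, hj]
    refine ⟨fun x => medianThree (g (p (-τ) x)) (g (p 0 x)) (g (p τ x)), ?_, fun x hx => ?_⟩
    · have h4 := (((hr (-τ)).union (hr 0)).union (hr τ)).mono_width (W' := 3 ^ (m + 1) * W)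
        (by rw [pow_succ]; nlinarith)
      have h5 : 7 ≤ 3 ^ (m + 1) * W := by
        have : 1 ≤ 3 ^ m := Nat.one_le_pow _ _ (by norm_num)
        rw [pow_succ]
        nlinarith
      exact h4.trans ((Reach.median _ _ _).mono_width h5)
    · have close : ∀ c, |c| ≤ |τ| → x i + c ∉ Bad → |g (p c x) - F x| ≤ ε + (m + 1 : ℕ) * η := by
        intro c hc hxc
        have h6 := h2 (p c x) fun j hj => by
          by_cases hji : j = i
          · subst hji; simpa [hp] using hxc
          · have : (j : ℕ) ≠ m := fun h => hji (Fin.ext h)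
            simpa [hp, hji] using hx j (by omega)
        have h7 := hF x i c hc
        have h8 := abs_sub_le (g (p c x)) (F (p c x)) (F x)
        push_cast
        linarith
      refine abs_medianThree_sub_le ?_
      rcases hBad (x i) with ⟨a, b⟩ | ⟨a, b⟩ | ⟨a, b⟩
      · exact Or.inl ⟨close _ (by simp) a, close _ (by simp) (by simpa using b)⟩
      · exact Or.inr (Or.inl ⟨close _ (by simp) a, close _ le_rfl b⟩)
      · exact Or.inr (Or.inr ⟨close _ (by simp) (by simpa using a), close _ le_rfl b⟩)

/-! ### Approximation at the points without bad coordinates -/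

/-- The number `Q t`, clamped to `[0, Q - 1]`. -/
noncomputable def scaledClamp (Q : ℕ) (t : ℝ) : ℝ := min (max 0 (Q * t)) (Q - 1)

/-- The numbers `t` such that the fractional part of `scaledClamp Q t` exceeds `2/3`. -/
def badPoints (Q : ℕ) : Set ℝ := {t | (⌊scaledClamp Q t⌋₊ : ℝ) + 2 / 3 < scaledClamp Q t}

theorem scaledClamp_nonneg {Q : ℕ} (hQ : 0 < Q) (t : ℝ) : 0 ≤ scaledClamp Q t := by
  have : (1 : ℝ) ≤ Q := by exact_mod_cast hQ
  exact le_min (le_max_left _ _) (by linarith)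

/-- Where the clamp is active the value is one of the integers `0`, `Q - 1`, hence never bad. -/
theorem exists_of_mem_badPoints {Q : ℕ} (hQ : 0 < Q) {t : ℝ} (ht : t ∈ badPoints Q) :
    ∃ m : ℕ, m + 2 / 3 < Q * t ∧ Q * t < m + 1 := by
  have hQ1 : (1 : ℝ) ≤ Q := by exact_mod_cast hQ
  have ht' : (⌊scaledClamp Q t⌋₊ : ℝ) + 2 / 3 < scaledClamp Q t := ht
  have hs : scaledClamp Q t = Q * t := by
    rcases le_total (Q * t) 0 with h | h
    · have : scaledClamp Q t = 0 := by
        rw [scaledClamp, max_eq_left h, min_eq_left (by linarith)]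
      rw [this] at ht'
      norm_num at ht'
    · rw [scaledClamp, max_eq_right h] at ht' ⊢
      rcases le_total (Q * t) (Q - 1) with h' | h'
      · exact min_eq_left h'
      · rw [min_eq_right h', ← Nat.cast_one, ← Nat.cast_sub hQ, Nat.floor_natCast] at ht'
        linarith
  rw [hs] at ht'
  exact ⟨_, ht', Nat.lt_floor_add_one _⟩

/-- After scaling, bad points lie in intervals of length `1/3` separated by gaps of length `2/3`, so
such a shift leaves one interval without reaching the next. -/
theorem notMem_badPoints_of_shift {Q : ℕ} (hQ : 0 < Q) {t t' : ℝ} (h₁ : 1 / 3 ≤ Q * (t' - t))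
    (h₂ : Q * (t' - t) ≤ 2 / 3) (ht : t ∈ badPoints Q) : t' ∉ badPoints Q := by
  intro ht'
  obtain ⟨m, hm₁, hm₂⟩ := exists_of_mem_badPoints hQ ht
  obtain ⟨m', hm'₁, hm'₂⟩ := exists_of_mem_badPoints hQ ht'
  rw [mul_sub] at h₁ h₂
  have e₁ : m < m' := by exact_mod_cast (by linarith : (m : ℝ) < m')
  have e₂ : m' < m + 1 := by exact_mod_cast (by linarith : (m' : ℝ) < m + 1)
  omega

theorem badPoints_shift {Q : ℕ} (hQ : 0 < Q) (t : ℝ) :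
    (t - 1 / (3 * Q) ∉ badPoints Q ∧ t ∉ badPoints Q) ∨
      (t - 1 / (3 * Q) ∉ badPoints Q ∧ t + 1 / (3 * Q) ∉ badPoints Q) ∨
      (t ∉ badPoints Q ∧ t + 1 / (3 * Q) ∉ badPoints Q) := by
  have hQ0 : (Q : ℝ) ≠ 0 := by positivity
  have h1 : Q * (t - (t - 1 / (3 * Q))) = 1 / 3 := by field_simp; ring
  have h2 : Q * (t + 1 / (3 * Q) - (t - 1 / (3 * Q))) = 2 / 3 := by field_simp; ring
  have h3 : Q * (t + 1 / (3 * Q) - t) = 1 / 3 := by field_simp; ring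
  by_cases ha : t - 1 / (3 * Q) ∈ badPoints Q
  · exact Or.inr (Or.inr ⟨notMem_badPoints_of_shift hQ (by rw [h1]) (by rw [h1]; norm_num) ha,
      notMem_badPoints_of_shift hQ (by rw [h2]; norm_num) (by rw [h2]) ha⟩)
  · by_cases hb : t ∈ badPoints Q
    · exact Or.inr (Or.inl ⟨ha,
        notMem_badPoints_of_shift hQ (by rw [h3]) (by rw [h3]; norm_num) hb⟩)
    · exact Or.inl ⟨ha, hb⟩

/-- The nearest point of the unit cube. -/
def clampCube {d : ℕ} (x : Fin d → ℝ) : Fin d → ℝ := fun i => max 0 (min (x i) 1)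

theorem clampCube_mem {d : ℕ} (x : Fin d → ℝ) : clampCube x ∈ unitCube d :=
  ⟨fun _ => le_max_left _ _, fun _ => max_le zero_le_one (min_le_right _ _)⟩

theorem clampCube_of_mem {d : ℕ} {x : Fin d → ℝ} (hx : x ∈ unitCube d) : clampCube x = x := by
  funext i
  have h0 : 0 ≤ x i := hx.1 i
  have h1 : x i ≤ 1 := hx.2 i
  simp [clampCube, h0, h1]

/-- One unit of `1 / Q` is due to the floor, the other to clamping at `Q - 1` instead of `Q`. -/
theorem abs_clampCube_sub_le {d Q : ℕ} (hQ : 0 < Q) (x : Fin d → ℝ) (i : Fin d) :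
    |clampCube x i - (⌊scaledClamp Q (x i)⌋₊ : ℝ) / Q| ≤ 2 / Q := by
  have hQ0 : (0 : ℝ) < Q := by exact_mod_cast hQ
  have h1 := Nat.floor_le (scaledClamp_nonneg hQ (x i))
  have h2 := Nat.lt_floor_add_one (scaledClamp Q (x i))
  have h3 : scaledClamp Q (x i) ≤ Q * clampCube x i ∧
      Q * clampCube x i ≤ scaledClamp Q (x i) + 1 := by
    have h4 : Q * clampCube x i = max 0 (min (Q * x i) Q) := by
      rw [clampCube, mul_max_of_nonneg _ _ hQ0.le, mul_min_of_nonneg _ _ hQ0.le, mul_zero, mul_one]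
    rw [h4, scaledClamp]
    have hQ1 : (1 : ℝ) ≤ Q := by exact_mod_cast hQ
    constructor
    · rcases le_total 0 (Q * x i) with h | h
      · rw [max_eq_right h]
        refine le_max_of_le_right (min_le_min le_rfl (by linarith))
      · rw [max_eq_left h]
        exact (min_le_left _ _).trans (le_max_left _ _)
    · rw [← min_add_add_right]
      refine max_le (le_min (by positivity) (by linarith)) (le_min ?_ ?_)
      · exact (min_le_left _ _).trans (by linarith [le_max_right 0 (Q * x i)])
      · exact (min_le_right _ _).trans (by linarith)
  have h4 : clampCube x i - (⌊scaledClamp Q (x i)⌋₊ : ℝ) / Q =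
      (Q * clampCube x i - ⌊scaledClamp Q (x i)⌋₊) / Q := by field_simp
  rw [h4, abs_div, abs_of_pos hQ0]
  gcongr
  rw [abs_le]
  constructor <;> linarith [h3.1, h3.2]

/-- Binary expansion with digits `± 1`: taking the sign of `c` as leading digit, `2 c ∓ 1` is again
in `[-1, 1]`, and an error made there is halved. -/
theorem exists_signed_bits (J : ℕ) : ∀ c : ℝ, |c| ≤ 1 → ∃ θ : ℕ → ℕ, (∀ j, θ j ≤ 1) ∧
    |c - ∑ j ∈ Finset.range J, (1 / 2 : ℝ) ^ (j + 1) * (2 * (θ j : ℝ) - 1)| ≤ (1 / 2) ^ J := by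
  induction J with
  | zero => exact fun c hc => ⟨fun _ => 0, by simp, by simpa using hc⟩
  | succ J ih =>
    intro c hc
    obtain ⟨b, hb, hcb⟩ : ∃ b : ℕ, b ≤ 1 ∧ |2 * c - (2 * (b : ℝ) - 1)| ≤ 1 := by
      obtain ⟨h1, h2⟩ := abs_le.1 hc
      rcases le_total 0 c with h | h
      · exact ⟨1, le_rfl, by rw [abs_le]; constructor <;> push_cast <;> linarith⟩
      · exact ⟨0, zero_le_one, by rw [abs_le]; constructor <;> push_cast <;> linarith⟩
    obtain ⟨θ, hθ, h⟩ := ih _ hcb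
    refine ⟨fun j => if j = 0 then b else θ (j - 1), fun j => ?_, ?_⟩
    · simp only
      split_ifs
      exacts [hb, hθ _]
    · rw [Finset.sum_range_succ']
      have e : c - (∑ j ∈ Finset.range J, (1 / 2 : ℝ) ^ (j + 1 + 1) *
            (2 * ((if j + 1 = 0 then b else θ (j + 1 - 1) : ℕ) : ℝ) - 1) +
          (1 / 2) ^ (0 + 1) * (2 * ((if 0 = 0 then b else θ (0 - 1) : ℕ) : ℝ) - 1)) =
          1 / 2 * (2 * c - (2 * (b : ℝ) - 1) -
            ∑ j ∈ Finset.range J, (1 / 2 : ℝ) ^ (j + 1) * (2 * (θ j : ℝ) - 1)) := by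
        simp only [Nat.add_eq_zero_iff, one_ne_zero, and_false, if_false, if_true,
          Nat.add_sub_cancel]
        have : ∑ j ∈ Finset.range J, (1 / 2 : ℝ) ^ (j + 1 + 1) * (2 * (θ j : ℝ) - 1) =
            1 / 2 * ∑ j ∈ Finset.range J, (1 / 2 : ℝ) ^ (j + 1) * (2 * (θ j : ℝ) - 1) := by
          rw [Finset.mul_sum]
          exact Finset.sum_congr rfl fun j _ => by ring
        rw [this]
        ring
      rw [e, abs_mul, pow_succ, mul_comm]
      gcongr
      norm_num

/-- Lists each variable with its multiplicity, the form consumed factor by factor in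
`Reach.monomial`. -/
theorem exists_list_prod_eq {ι M : Type*} [Fintype ι] [CommMonoid M] (α : ι → ℕ) :
    ∃ l : List ι, l.length = ∑ i, α i ∧ ∀ F : ι → M, (l.map F).prod = ∏ i, F i ^ α i := by
  refine ⟨Finset.univ.toList.flatMap fun i => List.replicate (α i) i, ?_, fun F => ?_⟩
  · rw [List.length_flatMap]
    simp [Finset.sum_map_toList]
  · rw [List.map_flatMap, List.flatMap, List.prod_flatten, List.map_map, ← Finset.prod_map_toList]
    simp [Function.comp_def]

theorem Reach.scaledClamp {X : Type*} {S : Set (X → ℝ)} {Q : ℕ} (hQ : 0 < Q) {u : X → ℝ}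
    (hu : u ∈ affineHull S) : Reach 2 1 S {fun x => scaledClamp Q (u x)} := by
  have hQ1 : (1 : ℝ) ≤ Q := by exact_mod_cast hQ
  have h := (Reach.single (affineHull_mul Q hu)).union
    (Reach.single (affineHull_sub (affineHull_mul Q hu) (affineHull_const ((Q : ℝ) - 1))))
  refine h.mono_right (Set.singleton_subset_iff.2 (affineHull_congr (affineHull_sub
    (subset_affineHull (Or.inl rfl)) (subset_affineHull (Or.inr rfl))) fun x => ?_))
  simp only [relu, _root_.scaledClamp]
  rcases le_total (Q * u x) (Q - 1) with h1 | h1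
  · rw [max_eq_left (a := 0) (b := Q * u x - (Q - 1)) (by linarith), sub_zero]
    exact min_eq_left (max_le (by linarith) h1)
  · rw [max_eq_right (a := 0) (b := Q * u x - (Q - 1)) (by linarith),
      max_eq_right (a := 0) (b := Q * u x) (by linarith), min_eq_right h1]
    ring

/-- The three error terms are the Taylor remainder, the truncation of the coefficients to `s m g`
bits, and the truncation of the point to the grid of mesh `1 / Q`. At most `s ^ d` monomials times
`s m` bit blocks run in parallel. -/
theorem exists_reach_approx_good {d s n ℓ m g K₁ K₂ : ℕ} (hd : 0 < d) (hs : 0 < s) (hn : 0 < n)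
    (hℓ : 0 < ℓ) (hm : 0 < m) (hg : 0 < g) (h₁ : 0 < K₁) (h₁n : K₁ ^ d ≤ n) (h₂ : 0 < K₂)
    (h₂ℓ : K₂ ^ d ≤ ℓ) {f : (Fin d → ℝ) → ℝ} (hf : ContDiffOn ℝ s f (unitCube d)) :
    ∃ φ : (Fin d → ℝ) → ℝ,
      Reach (17 * s ^ (d + 1) * d * (n + 2) * m) (18 * s ^ 2 * (ℓ + 2) * g)
        (Set.range fun (i : Fin d) (x : Fin d → ℝ) => x i) {φ} ∧
      ∀ x, (∀ i, x i ∉ badPoints ((4 * n) ^ (s * g) * K₂ * K₂ * K₁ * K₁)) →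
        |φ x - f (clampCube x)| ≤ (csNorm s f).toReal *
          ((s + 1) ^ d * (1 / (2 * (K₂ * K₂ * K₁ * K₁ : ℕ))) ^ s + s ^ d * (1 / 2) ^ (s * m * g) +
            2 ^ d * (2 / ((4 * n) ^ (s * g) * K₂ * K₂ * K₁ * K₁ : ℕ))) := by
  set A := (csNorm s f).toReal with hA_def
  have hA : 0 ≤ A := ENNReal.toReal_nonneg
  set P := (4 * n) ^ (s * g) with hP
  have hP0 : 0 < P := by positivity
  set K := K₂ * K₂ * K₁ * K₁ with hK
  have hK0 : 0 < K := by positivity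
  set Q := P * K₂ * K₂ * K₁ * K₁ with hQ
  have hQ0 : 0 < Q := by positivity
  have hQPK : Q = P * K := by rw [hQ, hK]; ring
  have hP0' : (0 : ℝ) < P := by exact_mod_cast hP0
  have hK0' : (0 : ℝ) < K := by exact_mod_cast hK0
  have hQ0' : (0 : ℝ) < Q := by exact_mod_cast hQ0
  have hQPK' : (Q : ℝ) = P * K := by exact_mod_cast hQPK
  -- On the subtype of good points `NearFloor` holds everywhere, so all digit extractions are exact.
  set X := {x : Fin d → ℝ // ∀ i, x i ∉ badPoints Q}
  set z : Fin d → X → ℝ := fun i x => scaledClamp Q (x.1 i) with hz_def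
  set k : Fin d → X → ℕ := fun i x => ⌊z i x⌋₊ with hk_def
  have hz : ∀ i, NearFloor (z i) (k i) := fun i x =>
    ⟨Nat.floor_le (scaledClamp_nonneg hQ0 _), not_lt.1 (x.2 i)⟩
  have hk : ∀ i x, k i x < Q := by
    intro i x
    have h1 : (k i x : ℝ) ≤ Q - 1 := (hz i x).1.trans (min_le_right _ _)
    exact_mod_cast (by linarith : (k i x : ℝ) < Q)
  obtain ⟨ι, _, α, hcard, hα, -, htaylor⟩ :=
    exists_taylor_along hs hf (List.Sublist.refl (List.finRange d))
  rw [List.length_finRange] at hcard htaylor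
  choose l hl_len hl_prod using fun t => exists_list_prod_eq (M := ℝ) (α t)
  -- The centre of the grid cell of `x`, and the Taylor coefficients there
  set y : X → Fin d → ℝ := fun x i => ((k i x / P : ℕ) + 1 / 2) / K with hy_def
  have hq : ∀ i x, ((k i x / P : ℕ) : ℝ) + 1 ≤ K := by
    intro i x
    have : k i x / P < K := Nat.div_lt_of_lt_mul (by rw [← hQPK]; exact hk i x)
    exact_mod_cast this
  have hy : ∀ x, y x ∈ unitCube d := by
    intro x
    constructor <;> intro i
    · simp only [hy_def, Pi.zero_apply]; positivity
    · simp only [hy_def, Pi.one_apply]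
      rw [div_le_one hK0']
      linarith [hq i x]
  -- The half side `1 / (2 K)` of a cell is absorbed into the coefficient, which leaves a monomial
  -- in the signed fractions.
  set C : ι → (Fin d → ℝ) → ℝ := fun t y =>
    multiPartialDeriv (α t) f y * ∏ j, (1 / (2 * K : ℝ)) ^ α t j / (α t j).factorial with hC_def
  have hC : ∀ t y, y ∈ unitCube d → |C t y| ≤ A := by
    intro t y hy
    have h1 := abs_multiPartialDeriv_le hf (hα t).le hy
    have h2 := abs_monomial_le (x := fun _ : Fin d => 1 / (2 * K : ℝ)) (y := fun _ => 0) (ρ := 1)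
      (fun j => ?_) (α t)
    · simp only [sub_zero, one_pow] at h2
      rw [hC_def, abs_mul]
      exact (mul_le_mul h1 h2 (abs_nonneg _) hA).trans_eq (mul_one _)
    · rw [sub_zero, abs_of_pos (by positivity), div_le_one (by positivity)]
      have : (1 : ℝ) ≤ K := by exact_mod_cast hK0
      linarith
  -- Default bits for `|c| > 1` make the choice a function on all of `ℝ`.
  have hbits : ∀ c : ℝ, ∃ θ : ℕ → ℕ, (∀ j, θ j ≤ 1) ∧ (|c| ≤ 1 →
      |c - ∑ j ∈ Finset.range (s * m * g), (1 / 2 : ℝ) ^ (j + 1) * (2 * (θ j : ℝ) - 1)| ≤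
        (1 / 2) ^ (s * m * g)) := by
    intro c
    by_cases hc : |c| ≤ 1
    · obtain ⟨θ, h1, h2⟩ := exists_signed_bits (s * m * g) c hc
      exact ⟨θ, h1, fun _ => h2⟩
    · exact ⟨fun _ => 0, by simp, fun h => absurd h hc⟩
  choose bits hbits1 hbits2 using hbits
  set v : ι → X → ℝ := fun t x => ((l t).map fun i => signedFraction P (k i x % P)).prod with hv_def
  set U : ι → ℕ → X → ℝ := fun t p x => ∑ j ∈ Finset.range g, (1 / 2) ^ (j + 1) *
    (2 * (bits (C t (y x) / A) (p * g + j) : ℝ) - 1) * v t x with hU_def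
  set c : ι → X → ℝ := fun t x => ∑ j ∈ Finset.range (s * m * g),
    (1 / 2 : ℝ) ^ (j + 1) * (2 * (bits (C t (y x) / A) j : ℝ) - 1) with hc_def
  have hUc : ∀ t x, ∑ p ∈ Finset.range (s * m), (1 / 2 : ℝ) ^ (p * g) * U t p x = c t x * v t x := by
    intro t x
    have h1 := sum_range_mul_div_mod (s * m) g fun p j => (1 / 2 : ℝ) ^ (p * g) *
      ((1 / 2) ^ (j + 1) * (2 * (bits (C t (y x) / A) (p * g + j) : ℝ) - 1))
    simp only [Nat.div_add_mod', ← mul_assoc, ← pow_add, ← add_assoc] at h1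
    simp only [hc_def, hU_def, h1, Finset.sum_mul, Finset.mul_sum, ← mul_assoc, ← pow_add,
      ← add_assoc]
  -- The network on the good points
  have r₁ := Reach.iUnion (S := Set.range fun (i : Fin d) (x : X) => x.1 i) fun i : Fin d =>
    Reach.scaledClamp hQ0 (u := fun x : X => x.1 i) (subset_affineHull ⟨i, rfl⟩)
  have r₂ := Reach.iUnion (S := ⋃ i, {z i})
    fun tp : ι × Fin (s * m) =>
    Reach.coeff_mul_monomial (S := ⋃ i, {z i}) (s := s) (θ := fun j x => bits (C tp.1 (y x) / A) (tp.2 * g + j))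
      hd hn hg h₁ h₁n h₂ h₂ℓ hz (fun i => subset_affineHull (Set.mem_iUnion.2 ⟨i, rfl⟩))
      hk (l := l tp.1) (by rw [hl_len]; exact hα _) (fun j x => hbits1 _ _) (fun j x x' hxx' => by
        rw [show y x = y x' from funext fun i => by simp only [hy_def, hP, hxx']])
  rw [Fintype.card_fin] at r₁
  rw [Fintype.card_prod, Fintype.card_fin] at r₂
  have hW : Fintype.card ι * (s * m) * (17 * d * (n + 2)) ≤ 17 * s ^ (d + 1) * d * (n + 2) * m := by
    calc Fintype.card ι * (s * m) * (17 * d * (n + 2))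
        ≤ s ^ d * (s * m) * (17 * d * (n + 2)) := by gcongr
      _ = 17 * s ^ (d + 1) * d * (n + 2) * m := by ring
  have hW' : d * 2 ≤ 17 * s ^ (d + 1) * d * (n + 2) * m := by
    have h1 : 1 ≤ s ^ (d + 1) := Nat.one_le_pow _ _ hs
    calc d * 2 ≤ 17 * 1 * d * (n + 2) * 1 := by nlinarith
      _ ≤ _ := by gcongr; omega
  have r := (r₁.mono_width hW').trans (r₂.mono_width hW)
  have hD : 1 + (18 * s ^ 2 * (ℓ + 2) * g - 1) = 18 * s ^ 2 * (ℓ + 2) * g :=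
    Nat.add_sub_cancel' (Nat.one_le_iff_ne_zero.2 (by positivity))
  rw [hD] at r
  -- The network is built over the good points; its weights then define `φ` on all of `ℝ^d`.
  obtain ⟨net, hnW, hnD, hnet⟩ := r.exists_net (φ := fun x =>
      A * ∑ t, ∑ p : Fin (s * m), (1 / 2 : ℝ) ^ ((p : ℕ) * g) * U t p x) (by
    refine affineHull_mul A (affineHull_sum fun t _ => affineHull_sum fun p _ =>
      affineHull_mul _ (subset_affineHull (Set.mem_iUnion.2 ⟨(t, p), rfl⟩))))
  refine ⟨fun x => net.eval x 0, ?_, ?_⟩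
  · rw [← hnD]
    refine ((net.reach (u := fun (i : Fin d) (x : Fin d → ℝ) => x i)
      (S := Set.range fun (i : Fin d) (x : Fin d → ℝ) => x i)
      fun i => subset_affineHull (Set.mem_range_self i)).mono_width hnW).mono_right
      (Set.singleton_subset_iff.2 (subset_affineHull (Set.mem_range_self (0 : Fin 1))))
  · intro x₀ hx₀
    set x : X := ⟨x₀, hx₀⟩
    simp only
    rw [hnet x]
    have e1 : A * ∑ t, ∑ p : Fin (s * m), (1 / 2 : ℝ) ^ ((p : ℕ) * g) * U t p x =
        ∑ t, A * c t x * v t x := by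
      rw [Finset.mul_sum]
      refine Finset.sum_congr rfl fun t _ => ?_
      rw [Fin.sum_univ_eq_sum_range (fun p => (1 / 2 : ℝ) ^ (p * g) * U t p x), hUc, mul_assoc]
    rw [e1]
    -- The truncated point
    set w : Fin d → ℝ := fun i => (k i x : ℝ) / Q with hw_def
    have hw : w ∈ unitCube d := by
      constructor <;> intro i
      · simp only [hw_def, Pi.zero_apply]; positivity
      · simp only [hw_def, Pi.one_apply]
        rw [div_le_one hQ0']
        exact_mod_cast (hk i x).le
    have hwy : ∀ i, w i - y x i = 1 / (2 * K) * signedFraction P (k i x % P) := by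
      intro i
      have h1 : (k i x : ℝ) = P * (k i x / P : ℕ) + (k i x % P : ℕ) := by
        exact_mod_cast (Nat.div_add_mod _ _).symm
      simp only [hw_def, hy_def, signedFraction]
      rw [h1, hQPK']
      field_simp
      ring
    have hmono : ∀ t, multiPartialDeriv (α t) f (y x) *
        ∏ j, (w j - y x j) ^ α t j / (α t j).factorial = C t (y x) * v t x := by
      intro t
      simp only [hC_def, hv_def]
      rw [hl_prod, mul_assoc, ← Finset.prod_mul_distrib]
      congr 1
      refine Finset.prod_congr rfl fun j _ => ?_
      rw [hwy, mul_pow]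
      ring
    have t1 := htaylor (ρ := 1 / (2 * K)) (by positivity) hw (hy x)
      (fun j hj => absurd (List.mem_finRange j) hj) fun j => by
        rw [hwy, abs_mul, abs_of_pos (by positivity)]
        exact mul_le_of_le_one_right (by positivity)
          (abs_signedFraction_le (Nat.mod_lt _ hP0))
    simp only [hmono] at t1
    have t2 : |∑ t, A * c t x * v t x - ∑ t, C t (y x) * v t x| ≤
        A * (s ^ d * (1 / 2) ^ (s * m * g)) := by
      rw [← Finset.sum_sub_distrib]
      refine (Finset.abs_sum_le_sum_abs _ _).trans ?_
      refine (Finset.sum_le_card_nsmul _ _ (A * (1 / 2) ^ (s * m * g)) fun t _ => ?_).trans ?_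
      · rw [← sub_mul, abs_mul]
        refine (mul_le_of_le_one_right (abs_nonneg _) (abs_prod_signedFraction_le
          (fun i => Nat.mod_lt (k i x) hP0) _)).trans ?_
        -- If the norm is zero the normalised coefficients are meaningless, but then all true
        -- coefficients vanish.
        rcases hA.eq_or_lt with h0 | h0
        · have := hC t (y x) (hy x)
          rw [← h0] at this ⊢
          rw [abs_nonpos_iff.1 this]
          simp
        · have h3 := hbits2 (C t (y x) / A) (by
            rw [abs_div, abs_of_pos h0, div_le_one h0]
            exact hC t _ (hy x))
          have h4 : A * c t x - C t (y x) = -(A * (C t (y x) / A - c t x)) := by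
            field_simp
            ring
          rw [h4, abs_neg, abs_mul, abs_of_pos h0]
          exact mul_le_mul_of_nonneg_left h3 hA
      · rw [nsmul_eq_mul, Finset.card_univ]
        have h3 : (Fintype.card ι : ℝ) ≤ (s : ℝ) ^ d := by exact_mod_cast hcard
        have h0 : 0 ≤ A * (1 / 2 : ℝ) ^ (s * m * g) := by positivity
        nlinarith
    have t3 := abs_sub_le_of_contDiffOn hs hf (List.Sublist.refl (List.finRange d))
      (ρ := 2 / Q) (by positivity) hw (clampCube_mem x₀)
      (fun j hj => absurd (List.mem_finRange j) hj) fun j => by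
        rw [abs_sub_comm]
        exact abs_clampCube_sub_le hQ0 x₀ j
    rw [List.length_finRange] at t3
    have t4 := abs_sub_le (∑ t, A * c t x * v t x) (∑ t, C t (y x) * v t x) (f (clampCube x₀))
    have t5 := abs_sub_le (∑ t, C t (y x) * v t x) (f w) (f (clampCube x₀))
    rw [abs_sub_comm _ (f w)] at t5
    refine (t4.trans (add_le_add t2 (t5.trans (add_le_add t1 t3)))).trans_eq ?_
    ring

/-! ### The approximation rate -/

theorem exists_pow_le_lt {d n : ℕ} (hd : 0 < d) (hn : 0 < n) :
    ∃ K : ℕ, 0 < K ∧ K ^ d ≤ n ∧ n ≤ (2 * K) ^ d := by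
  have h : ∃ m : ℕ, n < (m + 1) ^ d := ⟨n, (Nat.lt_succ_self n).trans_le (Nat.le_self_pow hd.ne' _)⟩
  classical
  have h1 := Nat.find_spec h
  have h2 : 0 < Nat.find h := by
    rw [Nat.find_pos, zero_add, one_pow]
    omega
  refine ⟨Nat.find h, h2, ?_, h1.le.trans (Nat.pow_le_pow_left (by omega) d)⟩
  have h3 := Nat.find_min h (Nat.sub_lt h2 one_pos)
  rwa [not_lt, Nat.sub_one_add_one h2.ne'] at h3

theorem two_mul_le_two_pow_log (n : ℕ) : 2 * n ≤ 2 ^ Nat.log 2 (4 * n) := by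
  have := Nat.lt_pow_succ_log_self (b := 2) (by norm_num) (4 * n)
  rw [pow_succ] at this
  omega

theorem two_le_log_four_mul {n : ℕ} (hn : 0 < n) : 2 ≤ Nat.log 2 (4 * n) :=
  Nat.le_log_of_pow_le (by norm_num) (by omega)

/-- The factor 4 makes both logarithms at least 2, so that their product dominates the sum that a
direct estimate of `(n ℓ)²` produces. -/
theorem mul_sq_le_two_pow_log_mul_log {n ℓ : ℕ} (hn : 0 < n) (hℓ : 0 < ℓ) :
    (n * ℓ) ^ 2 ≤ 2 ^ (Nat.log 2 (4 * n) * Nat.log 2 (4 * ℓ)) := by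
  obtain ⟨a, ha⟩ := Nat.exists_eq_add_of_le (two_le_log_four_mul hn)
  obtain ⟨b, hb⟩ := Nat.exists_eq_add_of_le (two_le_log_four_mul hℓ)
  have h1 := two_mul_le_two_pow_log n
  have h2 := two_mul_le_two_pow_log ℓ
  rw [ha, pow_add] at h1
  rw [hb, pow_add] at h2
  rw [ha, hb]
  calc (n * ℓ) ^ 2 ≤ (2 * 2 ^ a * (2 * 2 ^ b)) ^ 2 := by gcongr <;> omega
    _ = 2 ^ (4 + 2 * a + 2 * b) := by ring
    _ ≤ 2 ^ ((2 + a) * (2 + b)) := Nat.pow_le_pow_right (by norm_num) (by nlinarith)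

theorem mul_sq_le_pow_log {n ℓ : ℕ} (hn : 0 < n) (hℓ : 0 < ℓ) :
    (n * ℓ) ^ 2 ≤ (4 * n) ^ Nat.log 2 (4 * ℓ) := by
  have h2 := two_mul_le_two_pow_log ℓ
  calc (n * ℓ) ^ 2 ≤ (2 ^ Nat.log 2 (4 * ℓ)) ^ 2 * n ^ 2 := by
        rw [mul_pow, mul_comm]
        gcongr
        omega
    _ ≤ (2 ^ Nat.log 2 (4 * ℓ)) ^ 2 * n ^ Nat.log 2 (4 * ℓ) := by
        gcongr
        exact two_le_log_four_mul hℓ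
    _ = (4 * n) ^ Nat.log 2 (4 * ℓ) := by
        rw [mul_pow, ← pow_mul, mul_comm _ 2, pow_mul]
        norm_num

/-- A function from `C^s` is approximated on the cube at the rate `(n ℓ) ^ (-2 s / d)`. -/
theorem exists_reach_approx {d s n ℓ : ℕ} (hd : 0 < d) (hs : 0 < s) (hn : 0 < n) (hℓ : 0 < ℓ)
    {f : (Fin d → ℝ) → ℝ} (hf : ContDiffOn ℝ s f (unitCube d)) :
    ∃ φ : (Fin d → ℝ) → ℝ,
      Reach (3 ^ d * (17 * s ^ (d + 1) * d * (n + 2) * Nat.log 2 (4 * n)))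
        (18 * s ^ 2 * (ℓ + 2) * Nat.log 2 (4 * ℓ) + 2 * d)
        (Set.range fun (i : Fin d) (x : Fin d → ℝ) => x i) {φ} ∧
      ∀ x ∈ unitCube d, |φ x - f x| ≤ (csNorm s f).toReal *
        (85 * ((s : ℝ) + 1) ^ d * 8 ^ s * ((n : ℝ) * ℓ) ^ (-(2 * (s : ℝ) / d))) := by
  obtain ⟨K₁, h₁, h₁n, hn₁⟩ := exists_pow_le_lt hd hn
  obtain ⟨K₂, h₂, h₂ℓ, hℓ₂⟩ := exists_pow_le_lt hd hℓ
  have hm := two_le_log_four_mul hn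
  have hg := two_le_log_four_mul hℓ
  have hbits := mul_sq_le_two_pow_log_mul_log hn hℓ
  have hdigits := mul_sq_le_pow_log hn hℓ
  set m := Nat.log 2 (4 * n)
  set g := Nat.log 2 (4 * ℓ)
  obtain ⟨φ, hφ, hφf⟩ := exists_reach_approx_good hd hs hn hℓ (m := m) (g := g) (by omega)
    (by omega) h₁ h₁n h₂ h₂ℓ hf
  set A := (csNorm s f).toReal
  have hA : 0 ≤ A := ENNReal.toReal_nonneg
  set Q := (4 * n) ^ (s * g) * K₂ * K₂ * K₁ * K₁ with hQ
  have hQ0 : 0 < Q := by positivity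
  have hQ0' : (0 : ℝ) < Q := by exact_mod_cast hQ0
  have hτ : (0 : ℝ) < 1 / (3 * Q) := by positivity
  have hW : 3 ≤ 17 * s ^ (d + 1) * d * (n + 2) * m := by
    have h1 : 1 ≤ s ^ (d + 1) := Nat.one_le_pow _ _ hs
    calc 3 ≤ 17 * 1 * 1 * (0 + 2) * 1 := by norm_num
      _ ≤ _ := by gcongr <;> omega
  have hF : ∀ (x : Fin d → ℝ) i c, |c| ≤ |1 / (3 * (Q : ℝ))| →
      |f (clampCube (Function.update x i (x i + c))) - f (clampCube x)| ≤
        A * 2 * (1 / (3 * Q)) := by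
    intro x i c hc
    have hc' : |c| ≤ 1 / (3 * Q) := hc.trans_eq (abs_of_pos hτ)
    have h := abs_sub_le_of_contDiffOn hs hf (List.singleton_sublist.2 (List.mem_finRange i))
      hτ.le (clampCube_mem (Function.update x i (x i + c))) (clampCube_mem x)
      (fun j hj => ?_) fun j => ?_
    · rwa [List.length_singleton, pow_one] at h
    · simp [clampCube, List.mem_singleton.not.1 hj]
    · by_cases hj : j = i
      · subst hj
        refine le_trans ?_ hc'
        simp only [clampCube, Function.update_self]
        refine (abs_max_sub_max_le_max _ _ _ _).trans (max_le (by simp) ?_)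
        exact (abs_min_sub_min_le_max _ _ _ _).trans (max_le (by simp) (by simp))
      · simp [clampCube, hj]
  obtain ⟨ψ, hψ, hψf⟩ := hφ.exists_uniform hW (badPoints_shift hQ0) (F := fun x => f (clampCube x))
    (η := A * 2 * (1 / (3 * Q))) hF hφf
  refine ⟨ψ, hψ, fun x hx => ?_⟩
  have h3 := hψf x
  rw [clampCube_of_mem hx] at h3
  refine h3.trans ?_
  set R : ℝ := ((n : ℝ) * ℓ) ^ (-(2 * (s : ℝ) / d)) with hR
  have hnℓ : (1 : ℝ) ≤ (n : ℝ) * ℓ := by exact_mod_cast Nat.mul_pos hn hℓ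
  have hd' : (1 : ℝ) ≤ d := by exact_mod_cast hd
  have hR0 : 0 < R := by positivity
  -- The bit and grid errors are even of order `(n ℓ) ^ (-2 s)`; the division of the exponent by `d`
  -- is wasted on them.
  have hpow : ∀ q : ℕ, (n * ℓ) ^ 2 ≤ q → 1 / (q : ℝ) ^ s ≤ R := by
    intro q hq
    have hq' : ((n : ℝ) * ℓ) ^ 2 ≤ q := by exact_mod_cast hq
    rw [hR, Real.rpow_neg (by positivity), one_div]
    refine inv_anti₀ (by positivity) ?_
    calc ((n : ℝ) * ℓ) ^ (2 * (s : ℝ) / d) ≤ ((n : ℝ) * ℓ) ^ ((2 * s : ℕ) : ℝ) := by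
          refine Real.rpow_le_rpow_of_exponent_le hnℓ ?_
          push_cast
          exact div_le_self (by positivity) hd'
      _ = (((n : ℝ) * ℓ) ^ 2) ^ s := by rw [Real.rpow_natCast, pow_mul]
      _ ≤ (q : ℝ) ^ s := by gcongr
  -- Rounding the two roots down gives `n ℓ ≤ (4 K₁ K₂) ^ d`, so `(n ℓ) ^ (2 / d) ≤ 16 K`, and `1 /
  -- (2 K) = 8 / (16 K)` produces the factor `8 ^ s`.
  have b₁ : (1 / (2 * (K₂ * K₂ * K₁ * K₁ : ℕ)) : ℝ) ^ s ≤ 8 ^ s * R := by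
    have e1 : ((n : ℝ) * ℓ) ^ (2 * (s : ℝ) / d) ≤ (16 * (K₂ * K₂ * K₁ * K₁ : ℕ)) ^ s := by
      have e2 : (n : ℝ) * ℓ ≤ (4 * (K₁ * K₂) : ℝ) ^ d := by
        have : n * ℓ ≤ (4 * (K₁ * K₂)) ^ d := by
          calc n * ℓ ≤ (2 * K₁) ^ d * (2 * K₂) ^ d := Nat.mul_le_mul hn₁ hℓ₂
            _ = (4 * (K₁ * K₂)) ^ d := by rw [← mul_pow]; ring
        exact_mod_cast this
      calc ((n : ℝ) * ℓ) ^ (2 * (s : ℝ) / d)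
          ≤ ((4 * (K₁ * K₂) : ℝ) ^ d) ^ (2 * (s : ℝ) / d) :=
            Real.rpow_le_rpow (by positivity) e2 (by positivity)
        _ = (4 * (K₁ * K₂) : ℝ) ^ ((2 * s : ℕ) : ℝ) := by
            rw [← Real.rpow_natCast_mul (by positivity)]
            congr 1
            push_cast
            field_simp
        _ = (16 * (K₂ * K₂ * K₁ * K₁ : ℕ)) ^ s := by
            rw [Real.rpow_natCast, pow_mul]
            push_cast
            ring
    have e3 : (1 / (2 * (K₂ * K₂ * K₁ * K₁ : ℕ)) : ℝ) ^ s =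
        8 ^ s * (1 / (16 * (K₂ * K₂ * K₁ * K₁ : ℕ)) ^ s) := by
      rw [← one_div_pow, ← mul_pow]
      congr 1
      field_simp
      norm_num
    rw [e3, hR, Real.rpow_neg (by positivity), one_div (_ ^ s)]
    gcongr
  have b₂ : (1 / 2 : ℝ) ^ (s * m * g) ≤ R := by
    have := hpow _ hbits
    rwa [Nat.cast_pow, Nat.cast_ofNat, ← pow_mul, ← one_div_pow,
      show m * g * s = s * m * g by ring] at this
  have b₃ : 1 / (Q : ℝ) ≤ R := by
    refine le_trans ?_ (hpow _ hdigits)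
    refine one_div_le_one_div_of_le (by positivity) ?_
    rw [← Nat.cast_pow, ← pow_mul, mul_comm g s]
    have : 1 ≤ K₂ * K₂ * K₁ * K₁ := Nat.one_le_iff_ne_zero.2 (by positivity)
    have h4 : (4 * n) ^ (s * g) * 1 ≤ (4 * n) ^ (s * g) * (K₂ * K₂ * K₁ * K₁) :=
      Nat.mul_le_mul_left _ this
    rw [hQ]
    exact_mod_cast by simpa only [mul_one, ← mul_assoc] using h4
  have c₁ : (1 : ℝ) ≤ 8 ^ s := one_le_pow₀ (by norm_num)
  have hs' : (1 : ℝ) ≤ s := by exact_mod_cast hs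
  have c₂ : (s : ℝ) ^ d ≤ (s + 1) ^ d := by gcongr; linarith
  have c₃ : (2 : ℝ) ^ d ≤ (s + 1) ^ d := by gcongr; linarith
  have c₄ : (d : ℝ) ≤ (s + 1) ^ d :=
    le_trans (by exact_mod_cast Nat.lt_two_pow_self.le) c₃
  set Z : ℝ := ((s : ℝ) + 1) ^ d with hZ
  have hZ0 : 0 < Z := by positivity
  rw [show A * 2 * (1 / (3 * (Q : ℝ))) = A * (2 / 3 * (1 / Q)) by
    field_simp, show (2 : ℝ) / Q = 2 * (1 / Q) by ring]
  -- The Taylor, bit, grid and shift errors contribute at most `1`, `1`, `2` and `2/3` times `Z * 8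
  -- ^ s * R`, well below 85.
  have t₁ := mul_le_mul_of_nonneg_left b₁ hZ0.le
  have t₂ := mul_le_mul c₂ b₂ (by positivity) hZ0.le
  have t₃ := mul_le_mul c₃ (mul_le_mul_of_nonneg_left b₃ zero_le_two) (by positivity) hZ0.le
  have t₄ := mul_le_mul c₄ b₃ (by positivity) hZ0.le
  have t₅ : Z * R ≤ Z * R * 8 ^ s := le_mul_of_one_le_right (by positivity) c₁
  have := mul_le_mul_of_nonneg_left (a := A) (b := Z * (1 / (2 * (K₂ * K₂ * K₁ * K₁ : ℕ)) : ℝ) ^ s +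
    s ^ d * (1 / 2) ^ (s * m * g) + 2 ^ d * (2 * (1 / Q)) + d * (2 / 3 * (1 / Q)))
    (c := 85 * Z * 8 ^ s * R) ?_ hA
  · refine le_trans (le_of_eq ?_) this
    ring
  · have t₆ : 0 ≤ Z * R * 8 ^ s := by positivity
    nlinarith

/-- The choice of the integer parameter for a given network size. -/
theorem exists_parameter {c M : ℕ} (hc : 0 < c) (hM : 6 * c ≤ M) {Λ : ℝ}
    (hΛ : Real.logb 2 (4 * M + 4) ≤ Λ) :
    ∃ n : ℕ, 0 < n ∧ (M : ℝ) / (4 * c * Λ) ≤ n ∧ c * (n + 2) * Nat.log 2 (4 * n) ≤ M := by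
  have hΛ1 : 1 ≤ Λ := by
    refine le_trans ?_ hΛ
    rw [Real.le_logb_iff_rpow_le (by norm_num) (by positivity)]
    have : (0 : ℝ) ≤ M := Nat.cast_nonneg M
    norm_num
    linarith
  have hc' : (1 : ℝ) ≤ c := by exact_mod_cast hc
  set x := (M : ℝ) / (4 * c * Λ) with hx
  rcases le_or_gt x 1 with h | h
  -- For `n = 1` the cost is `c * 3 * 2`, which is what the lower bound `6 c ≤ M` pays for.
  · refine ⟨1, one_pos, by simpa using h, ?_⟩
    rw [show Nat.log 2 (4 * 1) = 2 by decide +kernel]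
    omega
  · have hx0 : 0 < x := by linarith
    have h1 : (⌈x⌉₊ : ℝ) < x + 1 := Nat.ceil_lt_add_one hx0.le
    have hxM : x ≤ M := div_le_self (Nat.cast_nonneg M) (by nlinarith)
    have hpos : 0 < ⌈x⌉₊ := Nat.ceil_pos.2 hx0
    refine ⟨⌈x⌉₊, hpos, Nat.le_ceil x, ?_⟩
    have h2 : (Nat.log 2 (4 * ⌈x⌉₊) : ℝ) ≤ Λ := by
      refine (Real.natLog_le_logb _ _).trans (le_trans ?_ hΛ)
      refine Real.logb_le_logb_of_le (by norm_num) (by positivity) ?_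
      push_cast
      linarith
    -- With `x > 1`, `⌈x⌉ + 2 < x + 3 < 4 x`; this is the origin of the 4 in the denominator of `x`.
    have h3 : (c : ℝ) * (⌈x⌉₊ + 2) * Nat.log 2 (4 * ⌈x⌉₊) ≤ c * (4 * x) * Λ := by
      gcongr
      linarith
    have h4 : (c : ℝ) * (4 * x) * Λ = M := by
      rw [hx]
      field_simp
    rw [h4] at h3
    exact_mod_cast h3

theorem mainTheorem2 (d s : ℕ) (hd : 0 < d) (hs : 0 < s) (f : (Fin d → ℝ) → ℝ)
    (hf : ContDiffOn ℝ s f (unitCube d)) (N L : ℕ)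
    (hN : 17 * s ^ (d + 1) * 3 ^ (d + 2) * d ≤ N) (hL : 108 * s ^ 2 + 2 * d ≤ L) :
    ∃ φ : (Fin d → ℝ) → ℝ, ImplementedByReLUNet N L φ ∧
      linftyNorm (fun x => φ x - f x) ≤
        ENNReal.ofReal (85 * ((s : ℝ) + 1) ^ d * 8 ^ s) * csNorm s f *
          ENNReal.ofReal
            (((N : ℝ) / (68 * (s : ℝ) ^ (d + 1) * 3 ^ d * d * Real.logb 2 (8 * N + 8)))
              ^ (-(2 * (s : ℝ) / d))) *
          ENNReal.ofReal
            ((((L : ℝ) - 2 * d) / (72 * (s : ℝ) ^ 2 * Real.logb 2 (4 * L + 4)))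
              ^ (-(2 * (s : ℝ) / d))) := by
  -- The constant 68 is `4 * 17`, and the hypothesis on `N` is `9 c ≤ N`, more than the required `6
  -- c`.
  obtain ⟨n, hn, hnX, hnW⟩ := exists_parameter (c := 17 * s ^ (d + 1) * 3 ^ d * d) (M := N)
    (Λ := Real.logb 2 (8 * N + 8)) (by positivity)
    (le_trans (by rw [pow_add 3 d 2]; nlinarith [Nat.zero_le (s ^ (d + 1) * 3 ^ d * d)]) hN)
    (Real.logb_le_logb_of_le (by norm_num) (by positivity) (by nlinarith [Nat.cast_nonneg (α := ℝ) N]))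
  -- The `2 d` layers of the medians are set aside; for the rest `108 = 6 * 18` and `72 = 4 * 18`.
  obtain ⟨M, rfl⟩ := Nat.exists_eq_add_of_le' (le_trans (Nat.le_add_left _ _) hL)
  obtain ⟨ℓ, hℓ, hℓY, hℓD⟩ := exists_parameter (c := 18 * s ^ 2) (M := M)
    (Λ := Real.logb 2 (4 * (M + 2 * d : ℕ) + 4)) (by positivity) (by omega)
    (Real.logb_le_logb_of_le (by norm_num) (by positivity) (by push_cast; nlinarith [Nat.cast_nonneg (α := ℝ) d]))
  obtain ⟨φ, hφ, hφf⟩ := exists_reach_approx hd hs hn hℓ hf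
  refine ⟨φ, ?_, ?_⟩
  · obtain ⟨net, h1, h2, h3⟩ := hφ.exists_net (subset_affineHull rfl)
    refine ⟨net, h1.trans (le_trans (le_of_eq ?_) hnW), by omega, fun x => (h3 x).symm⟩
    ring
  · set e : ℝ := -(2 * (s : ℝ) / d) with he
    have he0 : e ≤ 0 := by
      rw [he, neg_nonpos]
      positivity
    set A := (csNorm s f).toReal with hA
    have hN0 : (0 : ℝ) < N := by
      have : 0 < N := lt_of_lt_of_le (by positivity) hN
      exact_mod_cast this
    have hM0 : (0 : ℝ) < M := by
      have : 0 < 108 * s ^ 2 := by positivity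
      exact_mod_cast (by omega : 0 < M)
    have hlog₁ : 0 < Real.logb 2 (8 * N + 8) := Real.logb_pos (by norm_num) (by linarith)
    have hlog₂ : 0 < Real.logb 2 (4 * (M + 2 * d : ℕ) + 4) :=
      Real.logb_pos (by norm_num) (by
        have : (0 : ℝ) ≤ (M + 2 * d : ℕ) := Nat.cast_nonneg _
        linarith)
    have hs' : (0 : ℝ) < s := by exact_mod_cast hs
    have hd' : (0 : ℝ) < d := by exact_mod_cast hd
    set x := (N : ℝ) / (68 * (s : ℝ) ^ (d + 1) * 3 ^ d * d * Real.logb 2 (8 * N + 8)) with hx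
    set y := (((M + 2 * d : ℕ) : ℝ) - 2 * d) /
      (72 * (s : ℝ) ^ 2 * Real.logb 2 (4 * (M + 2 * d : ℕ) + 4)) with hy
    have hM : ((M + 2 * d : ℕ) : ℝ) - 2 * d = M := by push_cast; ring
    have hx0 : 0 < x := by positivity
    have hy0 : 0 < y := by rw [hy, hM]; positivity
    have hxn : x ≤ n := by
      refine le_trans (le_of_eq ?_) hnX
      rw [hx]
      congr 1
      push_cast
      ring
    have hyℓ : y ≤ ℓ := by
      refine le_trans (le_of_eq ?_) hℓY
      rw [hy, hM]
      congr 1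
      push_cast
      ring
    rw [← ENNReal.ofReal_toReal (csNorm_lt_top hf).ne, ← hA, ← ENNReal.ofReal_mul (by positivity),
      ← ENNReal.ofReal_mul (by positivity), ← ENNReal.ofReal_mul (by positivity)]
    rw [linftyNorm, eLpNorm_exponent_top]
    refine eLpNormEssSup_le_of_ae_bound ((ae_restrict_iff'
      (isCompact_Icc : IsCompact (unitCube d)).measurableSet).2
      (Filter.Eventually.of_forall fun z hz => (hφf z hz).trans ?_))
    rw [Real.mul_rpow (Nat.cast_nonneg n) (Nat.cast_nonneg ℓ)]
    have h1 := Real.rpow_le_rpow_of_nonpos hx0 hxn he0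
    have h2 := Real.rpow_le_rpow_of_nonpos hy0 hyℓ he0
    have h3 : 0 ≤ A := ENNReal.toReal_nonneg
    calc A * (85 * ((s : ℝ) + 1) ^ d * 8 ^ s * ((n : ℝ) ^ e * (ℓ : ℝ) ^ e))
        ≤ A * (85 * ((s : ℝ) + 1) ^ d * 8 ^ s * (x ^ e * y ^ e)) := by gcongr
      _ = 85 * ((s : ℝ) + 1) ^ d * 8 ^ s * A * x ^ e * y ^ e := by ring
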